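/- **Problem.** Let $f_1,\dots,f_n:\mathbb R\to\mathbb R$ be differentiable (not necessarily convex), $A=[a_1,\dots,a_n]^\top\in\mathbb R^{n\times p}$, $\mathcal F_i(x)=f_i(a_i^\top x)$, $\mathcal F=\frac1n\sum_i\mathcal F_i$. Let the coordinates be partitioned into $q$ blocks $\mathcal G_1,\dots,\mathcal G_q$, let $\Omega(x)=\sum_j\Omega_j(x_{\mathcal G_j})$ with norms $\Omega_j$, $\lambda>0$, and $\mathcal P=\mathcal F+\lambda\Omega$. Assume that * $\mathcal F$ is $\mu$-strongly convex: $\mathcal F(x')\ge\mathcal F(x)+\langle\nabla\mathcal F(x),x'-x\rangle+\frac\mu2\|x'-x\|^2$, with $\mu>0$; * each $\nabla\mathcal F_i$ is $L$-Lipschitz, with $L>0$; put $\kappa=L/\mu$; * each $f_i'$ is $\ell$-Lipschitz, with $\ell>0$ (this constant is used only in the screening rule). For a set $\mathcal B$ of blocks, vectors over $\mathcal B$ are regarded as vectors in $\mathbb R^p$ that vanish outside the blocks of $\mathcal B$; $x^*_{\mathcal B}$ denotes the minimizer of $\mathcal P$ over these vectors, and $x^*$ the minimizer over $\mathbb R^p$.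 Let $\Omega^D_{\mathcal B}(u)=\max\{\langle v,u\rangle: v \text{ over } \mathcal B,\ \Omega(v)\le1\}$, $\Omega_j^D=\Omega^D_{\{j\}}$, $\Omega_j^D(A_j)=\sup_{\|u\|\le1}\Omega_j^D(A_j^\top u)$ and $D(y)=-\frac1n\sum_i f_i^*(-y_i)$. **Sparse quantities.** $\Psi_i$ is the set of blocks that meet the nonzero coefficients of $\nabla\mathcal F_i$ (not identically zero as functions), $n_{\mathcal G}=|\{i:\mathcal G\in\Psi_i\}|$, $d_{\mathcal G}=n/n_{\mathcal G}$, $\Delta=\max_{\mathcal G}n_{\mathcal G}/n$. $D_i$ is the diagonal matrix with entries $d_{\mathcal G}$ on the blocks $\mathcal G\in\Psi_i$ and $0$ elsewhere, and $\phi_i(x)=\sum_{\mathcal G\in\Psi_i}d_{\mathcal G}\Omega_{\mathcal G}(x_{\mathcal G})$ (only blocks of the current active set are counted). **Algorithm (asynchronous Sha-DDSS).** Start from a deterministic $x_{\mathcal B_0}=x_0\in\mathbb R^p$ and the set $\mathcal B_0$ of all blocks. For $s=0,\dots,S-1$: 1. *Screening.* Let $\theta=(f_i'(a_i^\top x_{\mathcal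 B_s}))_i$ and $y^s=-\sigma\theta/\max\bigl(1,\Omega^D_{\mathcal B_s}(A^\top\sigma\theta)/c\bigr)$, where $\sigma>0$ and $0<c\le n\lambda$ are fixed normalization constants. $\mathcal B_{s+1}$ is obtained from $\mathcal B_s$ by removing all blocks $j$ with $$\Omega_j^D(A_j^\top y^s)+\Omega_j^D(A_j)\sqrt{2n\ell\,(\mathcal P(x_{\mathcal B_s})-D(y^s))}<n\lambda$$ (none if $D(y^s)=-\infty$). Let $x^0$ be the restriction of $x_{\mathcal B_s}$ to $\mathcal B_{s+1}$. 2. *Inner loop.* For $t=0,\dots,K-1$: a read $\hat x^t$ is made from the shared memory; $i=i_{s,t}$ is sampled; and $x^{t+1}=x^t+\delta_t$, where $$v_t=\bigl[\nabla\mathcal F_i(\hat x^t)-\nabla\mathcal F_i(x^0)+D_i\nabla\mathcal F(x^0)\bigr]_{\mathcal B_{s+1}},\qquad \delta_t=\operatorname{prox}_{\eta\lambda\phi_i}(\hat x^t-\eta v_t)-\hat x^t .$$ 3. $x_{\mathcal B_{s+1}}=x^K$. Reads are inconsistent with overlap bound $\tau\in\mathbb N$: in each coordinate, $\hat x^t$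 equals $x^t$ minus the updates $\delta_u$ of some (arbitrary, possibly random) set of indices $u$ with $\max(t-\tau,0)\le u<t$. Each $i_{s,t}$ is uniform on $\{1,\dots,n\}$ and independent of the history consisting of all earlier samples (of this and the earlier outer loops) together with all reads up to and including $\hat x^t$. **Theorem.** Suppose $\tau\le\frac1{10\sqrt\Delta}$, let $\eta=\min\{\frac1{24\kappa L},\frac{\kappa}{2L},\frac{\kappa}{10\tau L}\}$ (the last term is absent if $\tau=0$), and let $K$ be $\frac{4\log3}{\eta\mu}$ rounded up or down to an integer. Then, for every $S\ge0$, the screening is safe, i.e. $x^*_{\mathcal B_S}=x^*$ for every outcome; the random variable $\|x_{\mathcal B_S}-x^*_{\mathcal B_S}\|^2$ is integrable; and $$\mathbb E\,\|x_{\mathcal B_S}-x^*_{\mathcal B_S}\|^2\le\left(\tfrac23\right)^S\|x_0-x^*\|^2 .$$ -/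

import Mathlib

open MeasureTheory ProbabilityTheory

/-- Data of the composite problem `min_x (1/n) ∑ᵢ fᵢ(aᵢᵀ x) + lam * Ω(x)` on `ℝᵖ`:
the rows of `A` are the `aᵢ`, the map `blk` sends a coordinate to its block (this is the partition
of the coordinates into `q` blocks), and `Ω(x) = ∑ⱼ Ωⱼ(x_{Gⱼ})` with a norm `Ωⱼ` on each block. -/
structure CompositeProblem (n p q : ℕ) where
  A : Matrix (Fin n) (Fin p) ℝ
  f : Fin n → ℝ → ℝ
  blk : Fin p → Fin q
  reg : ∀ j : Fin q, Seminorm ℝ ({k : Fin p // blk k = j} → ℝ)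
  reg_definite : ∀ j v, reg j v = 0 → v = 0
  lam : ℝ
  lam_pos : 0 < lam

namespace CompositeProblem

variable {n p q : ℕ} (Q : CompositeProblem n p q)

/-! ### The objective -/

/-- The inner product `aᵢᵀ x`. -/
def rowProd (i : Fin n) (x : EuclideanSpace ℝ (Fin p)) : ℝ := ∑ k, Q.A i k * x k

/-- `F_i(x) = f_i(aᵢᵀ x)`. -/
def Fi (i : Fin n) (x : EuclideanSpace ℝ (Fin p)) : ℝ := Q.f i (Q.rowProd i x)

/-- `F(x) = (1/n) ∑ᵢ F_i(x)`. -/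
noncomputable def F (x : EuclideanSpace ℝ (Fin p)) : ℝ := (1 / (n : ℝ)) * ∑ i, Q.Fi i x

/-- `Ωⱼ(x_{Gⱼ})`. -/
def blockReg (j : Fin q) (x : EuclideanSpace ℝ (Fin p)) : ℝ := Q.reg j (fun k => x k.1)

/-- `Ω(x) = ∑ⱼ Ωⱼ(x_{Gⱼ})`. -/
def Omega (x : EuclideanSpace ℝ (Fin p)) : ℝ := ∑ j, Q.blockReg j x

/-- The primal objective `F + lam * Ω`. -/
noncomputable def primal (x : EuclideanSpace ℝ (Fin p)) : ℝ := Q.F x + Q.lam * Q.Omega x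

/-! ### Active sets

A set `B` of blocks stands for the coordinates in these blocks. Vectors over `B` are represented by
vectors of `ℝᵖ` that vanish on the other coordinates. -/

/-- Restriction of a vector to the coordinates in the blocks of `B`, filled up with zeros. -/
noncomputable def restr (B : Finset (Fin q)) (x : EuclideanSpace ℝ (Fin p)) :
    EuclideanSpace ℝ (Fin p) :=
  WithLp.toLp 2 (fun k => if Q.blk k ∈ B then x k else 0)

/-- `x` vanishes outside the blocks of `B`. -/
def SupportedOn (B : Finset (Fin q)) (x : EuclideanSpace ℝ (Fin p)) : Prop :=
  ∀ k, Q.blk k ∉ B → x k = 0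

/-- `z` solves the sub-problem over the active set `B`. For `B` the set of all blocks this is the
original problem. -/
def IsSolution (B : Finset (Fin q)) (z : EuclideanSpace ℝ (Fin p)) : Prop :=
  Q.SupportedOn B z ∧ ∀ w, Q.SupportedOn B w → Q.primal z ≤ Q.primal w

/-! ### Extended supports, block frequencies, reweighting -/

open Classical in
/-- The extended support of sample `i`: the blocks that meet the nonzero coefficients of the
gradient of `F_i`. -/
noncomputable def Psi (i : Fin n) : Finset (Fin q) :=
  Finset.univ.filter (fun j => ∃ k, Q.blk k = j ∧ ∃ x, gradient (Q.Fi i) x k ≠ 0)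

/-- The number of samples whose extended support contains block `j`. -/
noncomputable def occ (j : Fin q) : ℕ := (Finset.univ.filter (fun i => j ∈ Q.Psi i)).card

/-- The block sparsity: the largest frequency of a block. -/
noncomputable def Delta : ℝ := ⨆ j : Fin q, (Q.occ j : ℝ) / n

/-- The weight `n / n_G` of a block. -/
noncomputable def d (j : Fin q) : ℝ := (n : ℝ) / Q.occ j

/-- The diagonal reweighting matrix `D_i`, applied to a vector. -/
noncomputable def Dmul (i : Fin n) (w : EuclideanSpace ℝ (Fin p)) : EuclideanSpace ℝ (Fin p) :=
  WithLp.toLp 2 (fun k => if Q.blk k ∈ Q.Psi i then Q.d (Q.blk k) * w k else 0)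

/-- The reweighted regularizer `φ_i(x) = ∑_{G ∈ Ψ_i} d_G Ω_G(x)` over the active set `B`. -/
noncomputable def phi (B : Finset (Fin q)) (i : Fin n) (x : EuclideanSpace ℝ (Fin p)) : ℝ :=
  ∑ j ∈ Q.Psi i ∩ B, Q.d j * Q.blockReg j x

/-! ### The sparse variance-reduced proximal step -/

/-- The proximal operator `prox_{η h}(x') = argmin_x (1/(2η)) ‖x - x'‖² + h(x)`. -/
noncomputable def prox (η : ℝ) (h : EuclideanSpace ℝ (Fin p) → ℝ)
    (x' : EuclideanSpace ℝ (Fin p)) : EuclideanSpace ℝ (Fin p) :=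
  Classical.epsilon (fun z => ∀ w,
    1 / (2 * η) * ‖z - x'‖ ^ 2 + h z ≤ 1 / (2 * η) * ‖w - x'‖ ^ 2 + h w)

/-- The sparse variance-reduced gradient over `B` with sample `i`, at the read `xhat`, with
reference point `x0`. -/
noncomputable def vrGrad (B : Finset (Fin q)) (i : Fin n) (x0 xhat : EuclideanSpace ℝ (Fin p)) :
    EuclideanSpace ℝ (Fin p) :=
  Q.restr B (gradient (Q.Fi i) xhat - gradient (Q.Fi i) x0 + Q.Dmul i (gradient Q.F x0))

/-- The update `δ = prox_{η lam φ_i}(xhat - η v) - xhat`. -/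
noncomputable def delta (η : ℝ) (B : Finset (Fin q)) (i : Fin n)
    (x0 xhat : EuclideanSpace ℝ (Fin p)) : EuclideanSpace ℝ (Fin p) :=
  prox η (fun z => Q.lam * Q.phi B i z) (xhat - η • Q.vrGrad B i x0 xhat) - xhat

/-! ### Safe screening by the duality gap -/

/-- The vector `Aᵀ y`. -/
noncomputable def transMul (y : EuclideanSpace ℝ (Fin n)) : EuclideanSpace ℝ (Fin p) :=
  WithLp.toLp 2 (fun k => ∑ i, Q.A i k * y i)

/-- The dual norm `Ω^D(u) = max {⟨v, u⟩ : Ω(v) ≤ 1}` over the active set `B`; with `B = {j}` it is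
the dual norm of `Ωⱼ` applied to the block `j` of `u`. -/
noncomputable def dualNorm (B : Finset (Fin q)) (u : EuclideanSpace ℝ (Fin p)) : ℝ :=
  sSup {r | ∃ v, Q.SupportedOn B v ∧ Q.Omega v ≤ 1 ∧ r = inner ℝ v u}

/-- `Ωⱼ^D(Aⱼ) = sup {Ωⱼ^D(Aⱼᵀ u) : ‖u‖ ≤ 1}`. -/
noncomputable def blockOpNorm (j : Fin q) : ℝ :=
  sSup {r | ∃ u : EuclideanSpace ℝ (Fin n), ‖u‖ ≤ 1 ∧ r = Q.dualNorm {j} (Q.transMul u)}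

/-- The set whose supremum is the Fenchel conjugate `f_i^*(u)`. -/
def conjSet (i : Fin n) (u : ℝ) : Set ℝ := Set.range (fun z => u * z - Q.f i z)

/-- The Fenchel conjugate `f_i^*(u)`; meaningful where it is finite, that is, where `conjSet` is
bounded above. -/
noncomputable def conj (i : Fin n) (u : ℝ) : ℝ := sSup (Q.conjSet i u)

/-- `D(y)` is finite. -/
def DualFinite (y : EuclideanSpace ℝ (Fin n)) : Prop := ∀ i, BddAbove (Q.conjSet i (-(y i)))

/-- The dual objective `D(y) = -(1/n) ∑ᵢ f_i^*(-yᵢ)` (where it is finite). -/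
noncomputable def dual (y : EuclideanSpace ℝ (Fin n)) : ℝ :=
  -(1 / (n : ℝ)) * ∑ i, Q.conj i (-(y i))

/-- The residual `θ = (f_i'(aᵢᵀ x))ᵢ`. -/
noncomputable def residual (x : EuclideanSpace ℝ (Fin p)) : EuclideanSpace ℝ (Fin n) :=
  WithLp.toLp 2 (fun i => deriv (Q.f i) (Q.rowProd i x))

/-- The dual point `-g / max(1, Ω^D(A_Bᵀ g) / c)`, obtained from `g = σ θ` by scaling. -/
noncomputable def dualPoint (σ c : ℝ) (B : Finset (Fin q)) (x : EuclideanSpace ℝ (Fin p)) :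
    EuclideanSpace ℝ (Fin n) :=
  -((max 1 (Q.dualNorm B (Q.transMul (σ • Q.residual x)) / c))⁻¹ • (σ • Q.residual x))

/-- The screening test for block `j` at the primal point `x` and the dual point `y`. If
`D(y) = -∞`, the duality gap is infinite and no block passes. -/
def Eliminated (ℓ : ℝ) (x : EuclideanSpace ℝ (Fin p)) (y : EuclideanSpace ℝ (Fin n))
    (j : Fin q) : Prop :=
  Q.DualFinite y ∧
    Q.dualNorm {j} (Q.transMul y)
      + Q.blockOpNorm j * √(2 * (n * ℓ) * (Q.primal x - Q.dual y)) < n * Q.lam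

open Classical in
/-- The new active set: the blocks of `B` that are not eliminated. -/
noncomputable def screen (σ c ℓ : ℝ) (B : Finset (Fin q)) (x : EuclideanSpace ℝ (Fin p)) :
    Finset (Fin q) :=
  B.filter (fun j => ¬ Q.Eliminated ℓ x (Q.dualPoint σ c B x) j)

/-! ### Executions of the asynchronous algorithm -/

/-- A (random) execution of `S` outer loops, each with `K` inner iterations, of the asynchronous
shared-memory algorithm started at `x₀`, with step size `η` and overlap bound `τ`. The inner
iterations are numbered in the order in which the reads are completed. -/
structure ShaDDSS (σ c ℓ η : ℝ) (τ K S : ℕ) (x₀ : EuclideanSpace ℝ (Fin p))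
    {W : Type*} [mW : MeasurableSpace W] (Pr : Measure W) where
  /-- the active sets -/
  B : ℕ → W → Finset (Fin q)
  /-- the outer iterates -/
  x : ℕ → W → EuclideanSpace ℝ (Fin p)
  /-- the inner iterates: the reference point plus all updates of the earlier iterations -/
  xin : ℕ → ℕ → W → EuclideanSpace ℝ (Fin p)
  /-- the inconsistent reads from the shared memory -/
  xhat : ℕ → ℕ → W → EuclideanSpace ℝ (Fin p)
  /-- the sampled indices -/
  idx : ℕ → ℕ → W → Fin n
  /-- the history: `hist (s, t)` is what is known after the read and before the sampling of
  iteration `t` of outer loop `s` -/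
  hist : Filtration (ℕ ×ₗ ℕ) mW
  B_zero : ∀ ω, B 0 ω = Finset.univ
  x_zero : ∀ ω, x 0 ω = x₀
  B_succ : ∀ s < S, ∀ ω, B (s + 1) ω = Q.screen σ c ℓ (B s ω) (x s ω)
  xin_zero : ∀ s < S, ∀ ω, xin s 0 ω = Q.restr (B (s + 1) ω) (x s ω)
  xin_succ : ∀ s < S, ∀ t < K, ∀ ω,
    xin s (t + 1) ω =
      xin s t ω + Q.delta η (B (s + 1) ω) (idx s t ω) (xin s 0 ω) (xhat s t ω)
  x_succ : ∀ s < S, ∀ ω, x (s + 1) ω = xin s K ω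
  /-- In each coordinate, the read of iteration `t` misses the updates of a set `M` of earlier
  iterations, all of them among the last `τ` ones. -/
  read : ∀ s < S, ∀ t < K, ∀ ω, ∀ k, ∃ M ⊆ Finset.Ico (t - τ) t,
    xhat s t ω k = xin s t ω k
      - ∑ u ∈ M, Q.delta η (B (s + 1) ω) (idx s u ω) (xin s 0 ω) (xhat s u ω) k
  read_measurable : ∀ s < S, ∀ t < K, Measurable[hist (toLex (s, t))] (xhat s t)
  idx_measurable : ∀ s < S, ∀ t < K, ∀ a, toLex (s, t) < a → Measurable[hist a] (idx s t)
  /-- The samples are uniform. -/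
  idx_uniform : ∀ s < S, ∀ t < K, ∀ i, Pr {ω | idx s t ω = i} = (n : ENNReal)⁻¹
  /-- Each sample is independent of all earlier samples and of all reads up to its own one. -/
  idx_indep : ∀ s < S, ∀ t < K,
    Indep (MeasurableSpace.comap (idx s t) inferInstance) (hist (toLex (s, t))) Pr

end CompositeProblem

/-- The step size `min {1/(24κL), κ/(2L), κ/(10τL)}` with `κ = L/μ`; the last term is `+∞`, so it is
absent, for `τ = 0`. -/
noncomputable def ddssStep (μ L : ℝ) (τ : ℕ) : ℝ :=
  if τ = 0 then min (1 / (24 * (L / μ) * L)) ((L / μ) / (2 * L))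
  else min (min (1 / (24 * (L / μ) * L)) ((L / μ) / (2 * L))) ((L / μ) / (10 * τ * L))

/-! Safety is a deterministic fact. Let z solve the sub-problem over B and let θ be its residual. As
each f_i' is ℓ-Lipschitz, the Fenchel–Young inequality at s improves by (u - f_i'(s))²/(2ℓ). Summing
at s = aᵢᵀz for a feasible dual point y puts -θ within √(2nℓ(P(z) - D(y))) of y
(`norm_sq_sub_le_gap`), and P(z) ≤ P(x) makes the radius computable. Strong duality never enters, so
the f_i need not be convex. Optimality gives nλ Ω_j(z_j) ≤ ⟨z_j, -A_jᵀθ⟩, which the test contradicts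
unless z_j = 0 (`IsSolution.eq_zero_of_eliminated`). So z vanishes on every removed block, and all
the active sets that occur share one solution.

For the rate, fix a loop. The optimality condition of z, taken with the same block weights d_G as
the proximal step, cancels the gradient at z and leaves a centered gradient V
(`IsSolution.two_inner_delta_le`). The weights give V the mean ∇F(x̂) - ∇F(z) on the active set, so
strong convexity yields a decrease, while smoothness gives E‖V‖² ≤ 2L²(E‖x̂ - z‖² + E‖x⁰ - z‖²).

Stale reads are controlled by sparsity. The later of two updates lives on the extended support of a
sample independent of the earlier update, and this support meets each coordinate with frequency at
most Δ. Young's inequality then bounds their overlap by √Δ/2 times the sum of the second moments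
(`integral_absInner_upd_le_of_lt`).

With a_t = E‖x^t - z‖² and D_t = E‖δ_t‖² this becomes a_{t+1} ≤ (1 - ημ/2) a_t + (ημ/6) a_0 - (2/5)
D_t + (√Δ + (11/10)ημ) ∑ D_u, the sum running over the last τ steps. After geometric weighting the D
terms have a favourable sign (`le_of_window_recursion`), and a_K ≤ (1/3 + 1/3) a_0.

Measure theory stays elementary: the start is deterministic, and samples and missed sets range over
finite sets, so every random variable of the execution takes finitely many values. -/

/-! ### Convex analysis -/

/-- First-order optimality of a minimizer along a segment, for the sum of a differentiable and a
convex function. -/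
theorem inner_gradient_add_sub_nonneg {E : Type*} [NormedAddCommGroup E] [InnerProductSpace ℝ E]
    [CompleteSpace E] {φ h : E → ℝ} {z w g : E} (hφ : HasGradientAt φ g z)
    (hh : ConvexOn ℝ Set.univ h)
    (hmin : ∀ t ∈ Set.Ioc (0 : ℝ) 1, φ z + h z ≤ φ (z + t • (w - z)) + h (z + t • (w - z))) :
    0 ≤ inner ℝ g (w - z) + (h w - h z) := by
  have hd : HasDerivAt (fun t : ℝ => φ (z + t • (w - z))) (inner ℝ g (w - z)) 0 := by
    have h1 : HasDerivAt (fun t : ℝ => z + t • (w - z)) (w - z) 0 := by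
      simpa using ((hasDerivAt_id (0 : ℝ)).smul_const (w - z)).const_add z
    have h2 : HasFDerivAt φ (InnerProductSpace.toDual ℝ E g) (z + (0 : ℝ) • (w - z)) := by
      simpa using hφ.hasFDerivAt
    have h3 := h2.comp_hasDerivAt (0 : ℝ) h1
    rw [InnerProductSpace.toDual_apply_apply] at h3
    exact h3
  have hlim := hd.tendsto_slope_zero_right
  simp only [zero_add, zero_smul, add_zero] at hlim
  -- By convexity `h` grows by at most t(h w - h z) along the segment, so minimality bounds the
  -- difference quotient of `φ` from below, uniformly in t.
  have hlow : ∀ᶠ t : ℝ in nhdsWithin 0 (Set.Ioi 0),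
      -(h w - h z) ≤ t⁻¹ • (φ (z + t • (w - z)) - φ z) := by
    have : Set.Ioc (0 : ℝ) 1 ∈ nhdsWithin (0 : ℝ) (Set.Ioi 0) := Ioc_mem_nhdsGT one_pos
    filter_upwards [this] with t ht
    have h1 := hmin t ht
    have h2 : h (z + t • (w - z)) ≤ (1 - t) * h z + t * h w := by
      have := hh.2 (Set.mem_univ z) (Set.mem_univ w) (sub_nonneg.2 ht.2) ht.1.le (by ring)
      simp only [smul_eq_mul] at this
      have e : z + t • (w - z) = (1 - t) • z + t • w := by module
      rw [e]
      exact this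
    have h3 : t * (-(h w - h z)) ≤ φ (z + t • (w - z)) - φ z := by nlinarith
    rw [smul_eq_mul, ← div_eq_inv_mul, le_div_iff₀ ht.1]
    linarith
  have := ge_of_tendsto hlim hlow
  linarith

/-- The descent lemma on the real line. -/
theorem le_add_deriv_mul_add_sq {f : ℝ → ℝ} {ℓ : ℝ} (hf : Differentiable ℝ f)
    (hlip : ∀ z z', |deriv f z - deriv f z'| ≤ ℓ * |z - z'|) (z h : ℝ) :
    f (z + h) ≤ f z + deriv f z * h + ℓ / 2 * h ^ 2 := by
  have hder : ∀ t : ℝ, HasDerivAt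
      (fun t : ℝ => f (z + t * h) - t * (deriv f z * h) - ℓ / 2 * h ^ 2 * t ^ 2)
      ((deriv f (z + t * h) - deriv f z) * h - ℓ * h ^ 2 * t) t := by
    intro t
    have h1 : HasDerivAt (fun t : ℝ => z + t * h) h t := by
      simpa using ((hasDerivAt_id t).mul_const h).const_add z
    have h2 := (hf (z + t * h)).hasDerivAt.comp t h1
    have h3 : HasDerivAt (fun t : ℝ => t * (deriv f z * h)) (deriv f z * h) t := by
      simpa using (hasDerivAt_id t).mul_const (deriv f z * h)
    have h4 : HasDerivAt (fun t : ℝ => ℓ / 2 * h ^ 2 * t ^ 2) (ℓ / 2 * h ^ 2 * (2 * t)) t := by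
      simpa using (hasDerivAt_pow 2 t).const_mul (ℓ / 2 * h ^ 2)
    have h5 := (h2.sub h3).sub h4
    have e : deriv f (z + t * h) * h - deriv f z * h - ℓ / 2 * h ^ 2 * (2 * t)
        = (deriv f (z + t * h) - deriv f z) * h - ℓ * h ^ 2 * t := by ring
    rw [e] at h5
    exact h5
  have hanti : AntitoneOn
      (fun t : ℝ => f (z + t * h) - t * (deriv f z * h) - ℓ / 2 * h ^ 2 * t ^ 2)
      (Set.Icc 0 1) := by
    refine antitoneOn_of_deriv_nonpos (convex_Icc 0 1)
      (fun t _ => (hder t).continuousAt.continuousWithinAt)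
      (fun t _ => (hder t).differentiableAt.differentiableWithinAt) ?_
    intro t ht
    rw [interior_Icc] at ht
    rw [(hder t).deriv]
    have h1 := hlip (z + t * h) z
    have h2 : (deriv f (z + t * h) - deriv f z) * h
        ≤ |deriv f (z + t * h) - deriv f z| * |h| := by
      rw [← abs_mul]; exact le_abs_self _
    have h3 : |z + t * h - z| = t * |h| := by
      rw [add_sub_cancel_left, abs_mul, abs_of_pos ht.1]
    rw [h3] at h1
    have h4 := mul_le_mul_of_nonneg_right h1 (abs_nonneg h)
    have h5 : |h| * |h| = h ^ 2 := by rw [abs_mul_abs_self, sq]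
    have h6 : ℓ * (t * |h|) * |h| = ℓ * h ^ 2 * t := by rw [← h5]; ring
    linarith
  have := hanti (Set.left_mem_Icc.2 zero_le_one) (Set.right_mem_Icc.2 zero_le_one) zero_le_one
  simp at this
  linarith

/-- Quadratic lower bound for the conjugate of a function with Lipschitz derivative. -/
theorem conjugate_lower_bound {f : ℝ → ℝ} {ℓ : ℝ} (hℓ : 0 < ℓ) (hf : Differentiable ℝ f)
    (hlip : ∀ z z', |deriv f z - deriv f z'| ≤ ℓ * |z - z'|) (z u : ℝ) :
    ∃ w, u * z - f z + 1 / (2 * ℓ) * (u - deriv f z) ^ 2 ≤ u * w - f w := by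
  -- The maximizer of `u * w` minus the quadratic upper bound on `f w` from the descent lemma.
  refine ⟨z + (u - deriv f z) / ℓ, ?_⟩
  have h := le_add_deriv_mul_add_sq hf hlip z ((u - deriv f z) / ℓ)
  have e : u * (z + (u - deriv f z) / ℓ) - (f z + deriv f z * ((u - deriv f z) / ℓ)
      + ℓ / 2 * ((u - deriv f z) / ℓ) ^ 2) = u * z - f z + 1 / (2 * ℓ) * (u - deriv f z) ^ 2 := by
    field_simp; ring
  linarith

namespace CompositeProblem

theorem inner_eq_sum {p : ℕ} (x y : EuclideanSpace ℝ (Fin p)) :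
    inner ℝ x y = ∑ k, x k * y k := by
  simp [PiLp.inner_apply, mul_comm]

theorem norm_sq_eq_sum {p : ℕ} (x : EuclideanSpace ℝ (Fin p)) : ‖x‖ ^ 2 = ∑ k, x k ^ 2 := by
  simp [EuclideanSpace.norm_sq_eq]

/-! ### The proximal operator -/

/-- The choice in `prox` is meaningful only if a minimizer exists. It does: the objective is
continuous, and nonnegativity of `h` lets the quadratic term make it coercive. -/
theorem prox_isMin {p : ℕ} {η : ℝ} (hη : 0 < η) {h : EuclideanSpace ℝ (Fin p) → ℝ}
    (hc : Continuous h) (h0 : ∀ z, 0 ≤ h z) (x w : EuclideanSpace ℝ (Fin p)) :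
    1 / (2 * η) * ‖prox η h x - x‖ ^ 2 + h (prox η h x)
      ≤ 1 / (2 * η) * ‖w - x‖ ^ 2 + h w := by
  have hex : ∃ z, ∀ w, 1 / (2 * η) * ‖z - x‖ ^ 2 + h z ≤ 1 / (2 * η) * ‖w - x‖ ^ 2 + h w := by
    refine Continuous.exists_forall_le (by fun_prop) ?_
    have h1 : Filter.Tendsto (fun w : EuclideanSpace ℝ (Fin p) => ‖w - x‖)
        (Filter.cocompact _) Filter.atTop := by
      have := tendsto_dist_right_cocompact_atTop x
      simpa [dist_eq_norm] using this
    have h2 : Filter.Tendsto (fun w : EuclideanSpace ℝ (Fin p) => 1 / (2 * η) * ‖w - x‖ ^ 2)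
        (Filter.cocompact _) Filter.atTop :=
      ((Filter.tendsto_pow_atTop two_ne_zero).comp h1).const_mul_atTop (by positivity)
    exact Filter.tendsto_atTop_mono (fun w => le_add_of_nonneg_right (h0 w)) h2
  exact Classical.epsilon_spec hex w

/-- The first-order condition of the proximal problem: (x - prox)/η is a subgradient of `h` at the
proximal point. Everything later about the step uses only this. -/
theorem prox_inner_le {p : ℕ} {η : ℝ} (hη : 0 < η) {h : EuclideanSpace ℝ (Fin p) → ℝ}
    (hc : ConvexOn ℝ Set.univ h) (h0 : ∀ z, 0 ≤ h z) (x w : EuclideanSpace ℝ (Fin p)) :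
    inner ℝ (x - prox η h x) (w - prox η h x) ≤ η * (h w - h (prox η h x)) := by
  have hcont : Continuous h := continuousOn_univ.1 (hc.continuousOn isOpen_univ)
  have hmin := prox_isMin hη hcont h0 x
  set z := prox η h x
  have hg : HasGradientAt (fun y => 1 / (2 * η) * ‖y - x‖ ^ 2) ((1 / η) • (z - x)) z := by
    rw [hasGradientAt_iff_hasFDerivAt]
    have h1 := (((hasFDerivAt_id z).sub_const x).norm_sq).const_mul (1 / (2 * η))
    have e : InnerProductSpace.toDual ℝ _ ((1 / η) • (z - x)) = (1 / (2 * η)) • 2 •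
        (innerSL ℝ) (id z - x) ∘SL ContinuousLinearMap.id ℝ (EuclideanSpace ℝ (Fin p)) := by
      ext y
      simp only [InnerProductSpace.toDual_apply_apply, inner_smul_left, conj_trivial,
        smul_apply, ContinuousLinearMap.comp_apply,
        ContinuousLinearMap.id_apply, innerSL_apply_apply, id, nsmul_eq_mul, smul_eq_mul]
      push_cast
      field_simp
    rw [e]
    exact h1
  have := inner_gradient_add_sub_nonneg (w := w) hg hc (fun t _ => hmin _)
  rw [inner_smul_left] at this
  simp only [conj_trivial] at this
  have e : inner ℝ (x - z) (w - z) = - inner ℝ (z - x) (w - z) := by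
    rw [← inner_neg_left, neg_sub]
  rw [e]
  have h2 := mul_nonneg hη.le this
  rw [mul_add, ← mul_assoc, mul_one_div_cancel hη.ne', one_mul] at h2
  linarith

variable {n p q : ℕ} (Q : CompositeProblem n p q)

/-! ### Gradients -/

/-- The row `aᵢ` as a vector. -/
noncomputable def row (i : Fin n) : EuclideanSpace ℝ (Fin p) := WithLp.toLp 2 (Q.A i)

theorem rowProd_eq_inner (i : Fin n) (x : EuclideanSpace ℝ (Fin p)) :
    Q.rowProd i x = inner ℝ (Q.row i) x := by
  simp [rowProd, row, inner_eq_sum]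

theorem hasGradientAt_Fi (hdiff : ∀ i, Differentiable ℝ (Q.f i)) (i : Fin n)
    (x : EuclideanSpace ℝ (Fin p)) :
    HasGradientAt (Q.Fi i) (deriv (Q.f i) (Q.rowProd i x) • Q.row i) x := by
  rw [hasGradientAt_iff_hasFDerivAt]
  have h1 : HasFDerivAt (Q.rowProd i) (InnerProductSpace.toDual ℝ _ (Q.row i)) x := by
    have : Q.rowProd i = fun y => InnerProductSpace.toDual ℝ _ (Q.row i) y := by
      ext y; simp [rowProd_eq_inner]
    rw [this]
    exact ContinuousLinearMap.hasFDerivAt _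
  have := ((hdiff i) (Q.rowProd i x)).hasDerivAt.comp_hasFDerivAt x h1
  have e : InnerProductSpace.toDual ℝ _ (deriv (Q.f i) (Q.rowProd i x) • Q.row i)
      = deriv (Q.f i) (Q.rowProd i x) • InnerProductSpace.toDual ℝ _ (Q.row i) := by
    ext y; simp
  rw [e]
  exact this

theorem gradient_Fi (hdiff : ∀ i, Differentiable ℝ (Q.f i)) (i : Fin n)
    (x : EuclideanSpace ℝ (Fin p)) :
    gradient (Q.Fi i) x = deriv (Q.f i) (Q.rowProd i x) • Q.row i :=
  (Q.hasGradientAt_Fi hdiff i x).gradient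

theorem hasGradientAt_F (hdiff : ∀ i, Differentiable ℝ (Q.f i)) (x : EuclideanSpace ℝ (Fin p)) :
    HasGradientAt Q.F ((1 / (n : ℝ)) • ∑ i, gradient (Q.Fi i) x) x := by
  rw [hasGradientAt_iff_hasFDerivAt]
  have h : HasFDerivAt (fun y => ∑ i, Q.Fi i y)
      (∑ i, InnerProductSpace.toDual ℝ _ (gradient (Q.Fi i) x)) x :=
    HasFDerivAt.fun_sum fun i _ => by
      rw [gradient_Fi Q hdiff]
      exact (Q.hasGradientAt_Fi hdiff i x).hasFDerivAt
  have e : InnerProductSpace.toDual ℝ _ ((1 / (n : ℝ)) • ∑ i, gradient (Q.Fi i) x)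
      = (1 / (n : ℝ)) • ∑ i, InnerProductSpace.toDual ℝ _ (gradient (Q.Fi i) x) := by
    ext y
    simp only [InnerProductSpace.toDual_apply_apply, inner_smul_left, conj_trivial, sum_inner,
      smul_apply, sum_apply, smul_eq_mul]
  rw [e]
  exact h.const_mul (1 / (n : ℝ))

theorem gradient_F (hdiff : ∀ i, Differentiable ℝ (Q.f i)) (x : EuclideanSpace ℝ (Fin p)) :
    gradient Q.F x = (1 / (n : ℝ)) • ∑ i, gradient (Q.Fi i) x :=
  (Q.hasGradientAt_F hdiff x).gradient

theorem gradient_F_apply (hdiff : ∀ i, Differentiable ℝ (Q.f i)) (x : EuclideanSpace ℝ (Fin p))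
    (k : Fin p) : gradient Q.F x k = (1 / (n : ℝ)) * ∑ i, gradient (Q.Fi i) x k := by
  simp [gradient_F Q hdiff x]

theorem hasGradientAt_F' (hdiff : ∀ i, Differentiable ℝ (Q.f i)) (x : EuclideanSpace ℝ (Fin p)) :
    HasGradientAt Q.F (gradient Q.F x) x := by
  rw [gradient_F Q hdiff]; exact Q.hasGradientAt_F hdiff x

theorem gradient_Fi_apply_eq_zero {i : Fin n} {k : Fin p} (h : Q.blk k ∉ Q.Psi i)
    (x : EuclideanSpace ℝ (Fin p)) : gradient (Q.Fi i) x k = 0 := by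
  by_contra hne
  exact h (by simp only [Psi, Finset.mem_filter_univ]; exact ⟨k, rfl, x, hne⟩)

/-! ### The regularizer -/

/-- `Ωⱼ`, as a seminorm on the whole space. -/
noncomputable def blockSeminorm (j : Fin q) : Seminorm ℝ (EuclideanSpace ℝ (Fin p)) :=
  (Q.reg j).comp (σ₁₂ := RingHom.id ℝ)
    { toFun := fun x (k : {k : Fin p // Q.blk k = j}) => x k.1
      map_add' := fun _ _ => by ext; simp
      map_smul' := fun _ _ => by ext; simp }

theorem blockReg_congr {j : Fin q} {x y : EuclideanSpace ℝ (Fin p)}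
    (h : ∀ k, Q.blk k = j → x k = y k) : Q.blockReg j x = Q.blockReg j y := by
  unfold blockReg
  congr 1
  ext k
  exact h k.1 k.2

theorem blockReg_nonneg (j : Fin q) (x : EuclideanSpace ℝ (Fin p)) : 0 ≤ Q.blockReg j x :=
  apply_nonneg (Q.reg j) _

theorem blockReg_zero (j : Fin q) : Q.blockReg j 0 = 0 := map_zero (Q.blockSeminorm j)

theorem convexOn_blockReg (j : Fin q) : ConvexOn ℝ Set.univ (Q.blockReg j) :=
  (Q.blockSeminorm j).convexOn

theorem convexOn_weighted_blockReg (s : Finset (Fin q)) (c : Fin q → ℝ) (hc : ∀ j, 0 ≤ c j) :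
    ConvexOn ℝ Set.univ (fun x => ∑ j ∈ s, c j * Q.blockReg j x) := by
  classical
  induction s using Finset.induction_on with
  | empty => simpa using convexOn_const (0 : ℝ) convex_univ
  | insert a s ha ih =>
    simp only [Finset.sum_insert ha]
    exact ((Q.convexOn_blockReg a).smul (hc a)).add ih

theorem convexOn_Omega : ConvexOn ℝ Set.univ Q.Omega := by
  have h := Q.convexOn_weighted_blockReg Finset.univ (fun _ => 1) (fun _ => zero_le_one)
  simp only [one_mul] at h
  exact h

theorem Omega_nonneg (x : EuclideanSpace ℝ (Fin p)) : 0 ≤ Q.Omega x :=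
  Finset.sum_nonneg fun j _ => Q.blockReg_nonneg j x

theorem Omega_smul (a : ℝ) (x : EuclideanSpace ℝ (Fin p)) :
    Q.Omega (a • x) = |a| * Q.Omega x := by
  simp only [Omega, Finset.mul_sum]
  exact Finset.sum_congr rfl fun j _ => map_smul_eq_mul (Q.blockSeminorm j) a x

theorem apply_eq_zero_of_blockReg_eq_zero {j : Fin q} {x : EuclideanSpace ℝ (Fin p)}
    (h : Q.blockReg j x = 0) {k : Fin p} (hk : Q.blk k = j) : x k = 0 :=
  congrFun (Q.reg_definite j _ h) ⟨k, hk⟩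

theorem Omega_pos {x : EuclideanSpace ℝ (Fin p)} (hx : x ≠ 0) : 0 < Q.Omega x := by
  refine (Q.Omega_nonneg x).lt_of_ne' fun h => hx ?_
  have h' := (Finset.sum_eq_zero_iff_of_nonneg fun j _ => Q.blockReg_nonneg j x).1 h
  ext k
  exact Q.apply_eq_zero_of_blockReg_eq_zero (h' (Q.blk k) (Finset.mem_univ _)) rfl

/-- Compactness of the unit sphere and homogeneity. It bounds the sets in the dual norms, whose
`sSup` would otherwise be the junk value 0. -/
theorem exists_norm_le_Omega : ∃ m : ℝ, 0 < m ∧ ∀ x, ‖x‖ ≤ m * Q.Omega x := by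
  have hcont : Continuous Q.Omega :=
    continuousOn_univ.1 (Q.convexOn_Omega.continuousOn isOpen_univ)
  -- The sphere is empty exactly when the space is trivial.
  rcases (Metric.sphere (0 : EuclideanSpace ℝ (Fin p)) 1).eq_empty_or_nonempty with he | hne
  · refine ⟨1, one_pos, fun x => ?_⟩
    have : x = 0 := by
      by_contra hx
      have : (‖x‖⁻¹ • x) ∈ Metric.sphere (0 : EuclideanSpace ℝ (Fin p)) 1 := by
        simp [norm_smul, inv_mul_cancel₀ (norm_ne_zero_iff.2 hx)]
      rw [he] at this
      exact this
    subst this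
    simpa using Q.Omega_nonneg 0
  · obtain ⟨y, hy, hmin⟩ := (isCompact_sphere (0 : EuclideanSpace ℝ (Fin p)) 1).exists_isMinOn hne
      hcont.continuousOn
    have hy1 : ‖y‖ = 1 := by simpa using hy
    have hpos : 0 < Q.Omega y := Q.Omega_pos (norm_ne_zero_iff.1 (by rw [hy1]; exact one_ne_zero))
    refine ⟨(Q.Omega y)⁻¹, inv_pos.2 hpos, fun x => ?_⟩
    rcases eq_or_ne x 0 with rfl | hx
    · simpa using mul_nonneg (inv_pos.2 hpos).le (Q.Omega_nonneg 0)
    · have hx' : 0 < ‖x‖ := norm_pos_iff.2 hx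
      have h1 : Q.Omega y ≤ Q.Omega (‖x‖⁻¹ • x) := hmin (by
        simp [norm_smul, inv_mul_cancel₀ hx'.ne'])
      rw [Omega_smul, abs_of_pos (inv_pos.2 hx'), ← div_eq_inv_mul, le_div_iff₀ hx'] at h1
      rwa [← div_eq_inv_mul, le_div_iff₀ hpos, mul_comm]

/-! ### Restrictions -/

theorem restr_apply (B : Finset (Fin q)) (x : EuclideanSpace ℝ (Fin p)) (k : Fin p) :
    Q.restr B x k = if Q.blk k ∈ B then x k else 0 := rfl

theorem Dmul_apply (i : Fin n) (x : EuclideanSpace ℝ (Fin p)) (k : Fin p) :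
    Q.Dmul i x k = if Q.blk k ∈ Q.Psi i then Q.d (Q.blk k) * x k else 0 := rfl

theorem supportedOn_restr (B : Finset (Fin q)) (x : EuclideanSpace ℝ (Fin p)) :
    Q.SupportedOn B (Q.restr B x) := fun k hk => by simp [restr_apply, hk]

theorem norm_restr_sq_le (B : Finset (Fin q)) (x : EuclideanSpace ℝ (Fin p)) :
    ‖Q.restr B x‖ ^ 2 ≤ ‖x‖ ^ 2 := by
  rw [norm_sq_eq_sum, norm_sq_eq_sum]
  refine Finset.sum_le_sum fun k _ => ?_
  rw [restr_apply]
  split_ifs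
  · exact le_rfl
  · simpa using sq_nonneg (x k)

theorem norm_restr_sub_sq_le {B : Finset (Fin q)} {z : EuclideanSpace ℝ (Fin p)}
    (hz : Q.SupportedOn B z) (x : EuclideanSpace ℝ (Fin p)) :
    ‖Q.restr B x - z‖ ^ 2 ≤ ‖x - z‖ ^ 2 := by
  have : Q.restr B x - z = Q.restr B (x - z) := by
    ext k
    by_cases hk : Q.blk k ∈ B
    · simp [restr_apply, hk]
    · simp [restr_apply, hk, hz k hk]
  rw [this]
  exact Q.norm_restr_sq_le B _

variable {Q}

theorem SupportedOn.sub {B : Finset (Fin q)} {x y : EuclideanSpace ℝ (Fin p)}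
    (hx : Q.SupportedOn B x) (hy : Q.SupportedOn B y) : Q.SupportedOn B (x - y) :=
  fun k hk => by simp [hx k hk, hy k hk]

theorem SupportedOn.add {B : Finset (Fin q)} {x y : EuclideanSpace ℝ (Fin p)}
    (hx : Q.SupportedOn B x) (hy : Q.SupportedOn B y) : Q.SupportedOn B (x + y) :=
  fun k hk => by simp [hx k hk, hy k hk]

theorem SupportedOn.smul {B : Finset (Fin q)} {x : EuclideanSpace ℝ (Fin p)}
    (hx : Q.SupportedOn B x) (a : ℝ) : Q.SupportedOn B (a • x) :=
  fun k hk => by simp [hx k hk]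

/-! ### Solutions -/

theorem IsSolution.inner_nonneg (hdiff : ∀ i, Differentiable ℝ (Q.f i)) {B : Finset (Fin q)}
    {z w : EuclideanSpace ℝ (Fin p)} (hz : Q.IsSolution B z) (hw : Q.SupportedOn B w) :
    0 ≤ inner ℝ (gradient Q.F z) (w - z) + Q.lam * (Q.Omega w - Q.Omega z) := by
  have := inner_gradient_add_sub_nonneg (w := w) (Q.hasGradientAt_F' hdiff z)
    (Q.convexOn_Omega.smul Q.lam_pos.le)
    (fun t _ => hz.2 _ (hz.1.add ((hw.sub hz.1).smul t)))
  simp only [smul_eq_mul] at this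
  linarith

/-- Since Ω is separable, moving z inside one block gives an optimality condition for that block
alone. It serves both the screening test and, with arbitrary nonnegative block weights, the
reweighted proximal step. -/
theorem IsSolution.block_nonneg (hdiff : ∀ i, Differentiable ℝ (Q.f i)) {B : Finset (Fin q)}
    {z : EuclideanSpace ℝ (Fin p)} (hz : Q.IsSolution B z) {j : Fin q} (hj : j ∈ B)
    (w : EuclideanSpace ℝ (Fin p)) :
    0 ≤ ∑ k, (if Q.blk k = j then gradient Q.F z k * (w k - z k) else 0)
      + Q.lam * (Q.blockReg j w - Q.blockReg j z) := by
  have hs : Q.SupportedOn B (z + Q.restr {j} (w - z)) := by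
    refine hz.1.add fun k hk => ?_
    rw [restr_apply, if_neg]
    rintro h
    rw [Finset.mem_singleton] at h
    exact hk (h ▸ hj)
  have h := hz.inner_nonneg hdiff hs
  have e1 : inner ℝ (gradient Q.F z) (z + Q.restr {j} (w - z) - z)
      = ∑ k, (if Q.blk k = j then gradient Q.F z k * (w k - z k) else 0) := by
    rw [add_sub_cancel_left, inner_eq_sum]
    refine Finset.sum_congr rfl fun k _ => ?_
    simp [restr_apply]
  have e2 : Q.Omega (z + Q.restr {j} (w - z)) - Q.Omega z = Q.blockReg j w - Q.blockReg j z := by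
    rw [Omega, Omega, ← Finset.sum_sub_distrib, Finset.sum_eq_single j]
    · congr 1
      refine Q.blockReg_congr fun k hk => ?_
      simp [restr_apply, hk]
    · intro j' _ hj'
      rw [sub_eq_zero]
      refine Q.blockReg_congr fun k hk => ?_
      simp [restr_apply, hk, hj']
    · simp
  rwa [e1, e2] at h

theorem IsSolution.unique {μ : ℝ} (hμ : 0 < μ) (hdiff : ∀ i, Differentiable ℝ (Q.f i))
    (hconv : ∀ x x' : EuclideanSpace ℝ (Fin p),
      Q.F x + inner ℝ (gradient Q.F x) (x' - x) + μ / 2 * ‖x' - x‖ ^ 2 ≤ Q.F x')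
    {B : Finset (Fin q)} {z w : EuclideanSpace ℝ (Fin p)} (hz : Q.IsSolution B z)
    (hw : Q.IsSolution B w) : w = z := by
  have h1 := hz.inner_nonneg hdiff hw.1
  have h2 := hconv z w
  have h3 := hw.2 z hz.1
  simp only [primal] at h3
  have h4 : μ / 2 * ‖w - z‖ ^ 2 ≤ 0 := by linarith
  have h5 : ‖w - z‖ ^ 2 ≤ 0 := by
    by_contra! h
    have := mul_pos (half_pos hμ) h
    linarith
  have h6 : ‖w - z‖ = 0 := by
    have := sq_nonneg ‖w - z‖
    exact pow_eq_zero_iff two_ne_zero |>.1 (le_antisymm h5 this)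
  exact sub_eq_zero.1 (norm_eq_zero.1 h6)

theorem IsSolution.of_supportedOn {B B' : Finset (Fin q)} {z : EuclideanSpace ℝ (Fin p)}
    (hz : Q.IsSolution B z) (hB : B' ⊆ B) (hs : Q.SupportedOn B' z) : Q.IsSolution B' z :=
  ⟨hs, fun w hw => hz.2 w fun k hk => hw k fun h => hk (hB h)⟩

end CompositeProblem

namespace CompositeProblem

variable {n p q : ℕ} (Q : CompositeProblem n p q)

/-! ### Dual norms -/

theorem exists_inner_le : ∃ m : ℝ, 0 < m ∧ ∀ u v : EuclideanSpace ℝ (Fin p), Q.Omega v ≤ 1 →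
    inner ℝ v u ≤ m * ‖u‖ := by
  obtain ⟨m, hm, h⟩ := Q.exists_norm_le_Omega
  refine ⟨m, hm, fun u v hv => ?_⟩
  have h1 := real_inner_le_norm v u
  have h2 : ‖v‖ ≤ m := (h v).trans (mul_le_of_le_one_right hm.le hv)
  exact h1.trans (mul_le_mul_of_nonneg_right h2 (norm_nonneg u))

theorem bddAbove_dualNorm (B : Finset (Fin q)) (u : EuclideanSpace ℝ (Fin p)) :
    BddAbove {r | ∃ v, Q.SupportedOn B v ∧ Q.Omega v ≤ 1 ∧ r = inner ℝ v u} := by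
  obtain ⟨m, _, h⟩ := Q.exists_inner_le
  refine ⟨m * ‖u‖, ?_⟩
  rintro r ⟨v, _, hv, rfl⟩
  exact h u v hv

theorem inner_le_dualNorm_mul {B : Finset (Fin q)} {v : EuclideanSpace ℝ (Fin p)}
    (hv : Q.SupportedOn B v) (u : EuclideanSpace ℝ (Fin p)) :
    inner ℝ v u ≤ Q.dualNorm B u * Q.Omega v := by
  rcases eq_or_ne v 0 with rfl | hne
  · have : Q.Omega (0 : EuclideanSpace ℝ (Fin p)) = 0 := by
      simpa using Q.Omega_smul 0 0
    simp [this]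
  · have hpos := Q.Omega_pos hne
    have h : inner ℝ ((Q.Omega v)⁻¹ • v) u ≤ Q.dualNorm B u :=
      le_csSup (Q.bddAbove_dualNorm B u) ⟨_, hv.smul _, by
        rw [Omega_smul, abs_of_pos (inv_pos.2 hpos), inv_mul_cancel₀ hpos.ne'], rfl⟩
    rw [inner_smul_left, conj_trivial, ← div_eq_inv_mul, div_le_iff₀ hpos] at h
    exact h

/-- `y ↦ Aᵀ y` as a linear map. -/
noncomputable def transMulLin : EuclideanSpace ℝ (Fin n) →ₗ[ℝ] EuclideanSpace ℝ (Fin p) where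
  toFun := Q.transMul
  map_add' x y := by
    ext k; simp [transMul, mul_add, Finset.sum_add_distrib]
  map_smul' a x := by
    ext k
    simp only [transMul, PiLp.smul_apply, smul_eq_mul, RingHom.id_apply, Finset.mul_sum]
    exact Finset.sum_congr rfl fun i _ => by ring

theorem transMul_smul (a : ℝ) (x : EuclideanSpace ℝ (Fin n)) :
    Q.transMul (a • x) = a • Q.transMul x := Q.transMulLin.map_smul a x

theorem transMul_sub (x y : EuclideanSpace ℝ (Fin n)) :
    Q.transMul (x - y) = Q.transMul x - Q.transMul y := Q.transMulLin.map_sub x y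

theorem transMul_neg (x : EuclideanSpace ℝ (Fin n)) :
    Q.transMul (-x) = -Q.transMul x := Q.transMulLin.map_neg x

theorem inner_transMul (v : EuclideanSpace ℝ (Fin p)) (y : EuclideanSpace ℝ (Fin n)) :
    inner ℝ v (Q.transMul y) = ∑ i, y i * Q.rowProd i v := by
  rw [inner_eq_sum]
  simp only [transMul, rowProd, Finset.mul_sum]
  rw [Finset.sum_comm]
  exact Finset.sum_congr rfl fun i _ => Finset.sum_congr rfl fun k _ => by ring

theorem dualNorm_le_blockOpNorm {j : Fin q} {u : EuclideanSpace ℝ (Fin n)} (hu : ‖u‖ ≤ 1) :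
    Q.dualNorm {j} (Q.transMul u) ≤ Q.blockOpNorm j := by
  obtain ⟨m, hm, h⟩ := Q.exists_inner_le
  refine le_csSup ⟨m * ‖LinearMap.toContinuousLinearMap Q.transMulLin‖, ?_⟩ ⟨u, hu, rfl⟩
  rintro r ⟨u, hu, rfl⟩
  refine csSup_le ⟨0, 0, fun _ _ => rfl, ?_, by simp⟩ ?_
  · have : Q.Omega (0 : EuclideanSpace ℝ (Fin p)) = 0 := by
      simpa using Q.Omega_smul 0 0
    simp [this]
  · rintro r ⟨v, _, hv, rfl⟩
    refine (h _ v hv).trans (mul_le_mul_of_nonneg_left ?_ hm.le)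
    exact (LinearMap.toContinuousLinearMap Q.transMulLin).le_of_opNorm_le_of_le le_rfl hu |>.trans
      (by rw [mul_one])

theorem inner_transMul_le_blockOpNorm {j : Fin q} {v : EuclideanSpace ℝ (Fin p)}
    (hv : Q.SupportedOn {j} v) (w : EuclideanSpace ℝ (Fin n)) :
    inner ℝ v (Q.transMul w) ≤ Q.blockOpNorm j * ‖w‖ * Q.Omega v := by
  rcases eq_or_ne w 0 with rfl | hne
  · have : Q.transMul 0 = 0 := Q.transMulLin.map_zero
    simp [this]
  · have hpos : 0 < ‖w‖ := norm_pos_iff.2 hne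
    have h1 := Q.inner_le_dualNorm_mul hv (Q.transMul (‖w‖⁻¹ • w))
    have h2 := Q.dualNorm_le_blockOpNorm (j := j) (u := ‖w‖⁻¹ • w) (by
      rw [norm_smul, norm_inv, norm_norm, inv_mul_cancel₀ hpos.ne'])
    have h3 := h1.trans (mul_le_mul_of_nonneg_right h2 (Q.Omega_nonneg v))
    rw [transMul_smul, inner_smul_right, ← div_eq_inv_mul, div_le_iff₀ hpos] at h3
    linarith

/-- The scaling factor is chosen so that the dual norm of `Aᵀ y` over `B` is at most `c`.
Feasibility is thus obtained only against vectors over `B`, which suffices since the solution is one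
of them. -/
theorem inner_transMul_dualPoint_le {σ c : ℝ} (hc : 0 < c) {B : Finset (Fin q)}
    (x : EuclideanSpace ℝ (Fin p)) {v : EuclideanSpace ℝ (Fin p)} (hv : Q.SupportedOn B v) :
    inner ℝ v (Q.transMul (Q.dualPoint σ c B x)) ≤ c * Q.Omega v := by
  unfold dualPoint
  set g := σ • Q.residual x
  set M := max 1 (Q.dualNorm B (Q.transMul g) / c)
  have hM : 0 < M := lt_max_of_lt_left one_pos
  have h1 := Q.inner_le_dualNorm_mul (v := (-1 : ℝ) • v) (hv.smul (-1)) (Q.transMul g)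
  rw [Omega_smul, abs_neg, abs_one, one_mul, neg_one_smul, inner_neg_left] at h1
  have h2 : Q.dualNorm B (Q.transMul g) ≤ M * c := (div_le_iff₀ hc).1 (le_max_right _ _)
  rw [transMul_neg, transMul_smul, inner_neg_right, inner_smul_right, ← mul_neg,
    ← div_eq_inv_mul, div_le_iff₀ hM]
  have h3 := mul_le_mul_of_nonneg_right h2 (Q.Omega_nonneg v)
  linarith

/-! ### Safety of the screening rule -/

/-- Every dual feasible point lies in the ball around `(-f_i'(aᵢᵀ z))ᵢ` given by the duality gap. -/
theorem norm_sq_sub_le_gap {ℓ : ℝ} (hn : 0 < n) (hℓ : 0 < ℓ)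
    (hdiff : ∀ i, Differentiable ℝ (Q.f i))
    (hscalar : ∀ i, ∀ z z' : ℝ, |deriv (Q.f i) z - deriv (Q.f i) z'| ≤ ℓ * |z - z'|)
    {z : EuclideanSpace ℝ (Fin p)} {y : EuclideanSpace ℝ (Fin n)} (hy : Q.DualFinite y)
    (hfeas : inner ℝ z (Q.transMul y) ≤ n * Q.lam * Q.Omega z) :
    ‖-Q.residual z - y‖ ^ 2 ≤ 2 * (n * ℓ) * (Q.primal z - Q.dual y) := by
  have hn' : (0 : ℝ) < n := Nat.cast_pos.2 hn
  -- Fenchel–Young at aᵢᵀz with its quadratic gain. After summation the linear terms form ⟨z, Aᵀy⟩,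
  -- which feasibility bounds by the regularizer.
  have hconj : ∀ i, -(y i) * Q.rowProd i z - Q.Fi i z
      + 1 / (2 * ℓ) * ((-Q.residual z - y) i) ^ 2 ≤ Q.conj i (-(y i)) := by
    intro i
    obtain ⟨w, hw⟩ := conjugate_lower_bound hℓ (hdiff i) (hscalar i) (Q.rowProd i z) (-(y i))
    have h2 : -(y i) * w - Q.f i w ≤ Q.conj i (-(y i)) := le_csSup (hy i) ⟨w, rfl⟩
    have e : ((-Q.residual z - y) i) ^ 2 = (-(y i) - deriv (Q.f i) (Q.rowProd i z)) ^ 2 := by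
      simp only [residual, PiLp.sub_apply, PiLp.neg_apply]
      ring
    rw [e]
    exact hw.trans h2
  have hsum := Finset.sum_le_sum fun i (_ : i ∈ Finset.univ) => hconj i
  rw [Finset.sum_add_distrib, Finset.sum_sub_distrib, ← Finset.mul_sum, ← norm_sq_eq_sum] at hsum
  simp only [neg_mul, Finset.sum_neg_distrib] at hsum
  rw [← inner_transMul] at hsum
  have e : Q.primal z - Q.dual y = (1 / (n : ℝ)) * (∑ i, Q.Fi i z + ∑ i, Q.conj i (-(y i))
      + n * Q.lam * Q.Omega z) := by
    simp only [primal, F, dual]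
    field_simp
    ring
  rw [e]
  have h3 : 1 / (2 * ℓ) * ‖-Q.residual z - y‖ ^ 2
      ≤ ∑ i, Q.Fi i z + ∑ i, Q.conj i (-(y i)) + n * Q.lam * Q.Omega z := by linarith
  have e2 : 2 * (n * ℓ) * ((1 / (n : ℝ)) * (∑ i, Q.Fi i z + ∑ i, Q.conj i (-(y i))
      + n * Q.lam * Q.Omega z)) = 2 * ℓ * (∑ i, Q.Fi i z + ∑ i, Q.conj i (-(y i))
      + n * Q.lam * Q.Omega z) := by field_simp
  rw [e2]
  have h4 := mul_le_mul_of_nonneg_left h3 (by positivity : 0 ≤ 2 * ℓ)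
  rw [← mul_assoc, mul_one_div_cancel (by positivity), one_mul] at h4
  exact h4

theorem gradient_F_eq_transMul (hdiff : ∀ i, Differentiable ℝ (Q.f i))
    (z : EuclideanSpace ℝ (Fin p)) :
    gradient Q.F z = (1 / (n : ℝ)) • Q.transMul (Q.residual z) := by
  ext k
  rw [gradient_F_apply Q hdiff]
  simp only [gradient_Fi Q hdiff, PiLp.smul_apply, smul_eq_mul, transMul, residual, row]
  congr 1
  exact Finset.sum_congr rfl fun i _ => mul_comm _ _

/-- For the block part v of z, optimality gives nλΩ(v) ≤ ⟨v, -Aᵀθ⟩ with θ the residual at z.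
Splitting -θ = y + (-θ - y) and using the gap ball bounds the right side by the left side of the
test times Ω(v), so Ω(v) > 0 is impossible. -/
theorem IsSolution.eq_zero_of_eliminated {Q : CompositeProblem n p q} {σ c ℓ : ℝ} (hn : 0 < n)
    (hℓ : 0 < ℓ) (hdiff : ∀ i, Differentiable ℝ (Q.f i))
    (hscalar : ∀ i, ∀ z z' : ℝ, |deriv (Q.f i) z - deriv (Q.f i) z'| ≤ ℓ * |z - z'|)
    (hc : 0 < c) (hc' : c ≤ n * Q.lam) {B : Finset (Fin q)} {z x : EuclideanSpace ℝ (Fin p)}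
    (hz : Q.IsSolution B z) (hx : Q.SupportedOn B x) {j : Fin q} (hj : j ∈ B)
    (hel : Q.Eliminated ℓ x (Q.dualPoint σ c B x) j) {k : Fin p} (hk : Q.blk k = j) : z k = 0 := by
  have hn' : (0 : ℝ) < n := Nat.cast_pos.2 hn
  obtain ⟨hfin, hlt⟩ := hel
  set y := Q.dualPoint σ c B x
  have hfeas : inner ℝ z (Q.transMul y) ≤ n * Q.lam * Q.Omega z :=
    (Q.inner_transMul_dualPoint_le hc x hz.1).trans
      (mul_le_mul_of_nonneg_right hc' (Q.Omega_nonneg z))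
  have hball := Q.norm_sq_sub_le_gap hn hℓ hdiff hscalar hfin hfeas
  have hball' : ‖-Q.residual z - y‖ ≤ √(2 * (n * ℓ) * (Q.primal x - Q.dual y)) := by
    refine Real.le_sqrt_of_sq_le (hball.trans ?_)
    -- The ball holds with the gap at the unknown z; P(z) ≤ P(x) passes to the gap at the iterate.
    have := hz.2 x hx
    gcongr
  set v := Q.restr {j} z
  have hv : Q.SupportedOn {j} v := Q.supportedOn_restr _ _
  have hOv : Q.Omega v = Q.blockReg j z := by
    rw [Omega, Finset.sum_eq_single j]
    · exact Q.blockReg_congr fun k hk => by simp [v, restr_apply, hk]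
    · intro j' _ hj'
      rw [← Q.blockReg_zero j']
      exact Q.blockReg_congr fun k hk => by simp [v, restr_apply, hk, hj']
    · simp
  -- Comparison with the point whose block `j` is set to zero.
  have hopt := hz.block_nonneg hdiff hj 0
  have e : ∑ k, (if Q.blk k = j then gradient Q.F z k * ((0 : EuclideanSpace ℝ (Fin p)) k - z k)
      else 0) = - inner ℝ v (gradient Q.F z) := by
    rw [inner_eq_sum, ← Finset.sum_neg_distrib]
    refine Finset.sum_congr rfl fun k _ => ?_
    simp only [v, restr_apply, Finset.mem_singleton, PiLp.zero_apply]
    split_ifs <;> ring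
  rw [e, gradient_F_eq_transMul Q hdiff, inner_smul_right, blockReg_zero] at hopt
  have h1 := Q.inner_le_dualNorm_mul hv (Q.transMul y)
  have h2 := Q.inner_transMul_le_blockOpNorm hv (-Q.residual z - y)
  rw [transMul_sub, transMul_neg, inner_sub_right, inner_neg_right] at h2
  have hop : 0 ≤ Q.blockOpNorm j := by
    have h3 := Q.dualNorm_le_blockOpNorm (j := j) (u := 0) (by simp)
    refine le_trans ?_ h3
    exact le_csSup (Q.bddAbove_dualNorm _ _) ⟨0, fun _ _ => rfl, by
      have : Q.Omega (0 : EuclideanSpace ℝ (Fin p)) = 0 := by simpa using Q.Omega_smul 0 0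
      simp [this], by simp⟩
  have h3 := mul_le_mul_of_nonneg_left hball' hop
  have hO := Q.Omega_nonneg v
  have h4 := mul_le_mul_of_nonneg_right h3 hO
  have h5 : n * (Q.lam * Q.Omega v) ≤ - inner ℝ v (Q.transMul (Q.residual z)) := by
    rw [hOv]
    have h6 := mul_nonneg hn'.le hopt
    have h7 : (n : ℝ) * (-(1 / (n : ℝ) * inner ℝ v (Q.transMul (Q.residual z)))
      + Q.lam * (0 - Q.blockReg j z)) = - inner ℝ v (Q.transMul (Q.residual z))
      - n * (Q.lam * Q.blockReg j z) := by field_simp; ring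
    rw [h7] at h6
    linarith
  have h6 : Q.Omega v = 0 := by
    by_contra hne
    have hpos := hO.lt_of_ne' hne
    have := mul_lt_mul_of_pos_right hlt hpos
    nlinarith
  exact Q.apply_eq_zero_of_blockReg_eq_zero (hOv ▸ h6) hk

theorem IsSolution.screen {Q : CompositeProblem n p q} {σ c ℓ : ℝ} (hn : 0 < n)
    (hℓ : 0 < ℓ) (hdiff : ∀ i, Differentiable ℝ (Q.f i))
    (hscalar : ∀ i, ∀ z z' : ℝ, |deriv (Q.f i) z - deriv (Q.f i) z'| ≤ ℓ * |z - z'|)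
    (hc : 0 < c) (hc' : c ≤ n * Q.lam) {B : Finset (Fin q)} {z x : EuclideanSpace ℝ (Fin p)}
    (hz : Q.IsSolution B z) (hx : Q.SupportedOn B x) :
    Q.IsSolution (Q.screen σ c ℓ B x) z := by
  classical
  refine hz.of_supportedOn (Finset.filter_subset _ _) fun k hk => ?_
  by_cases hB : Q.blk k ∈ B
  · have hel : Q.Eliminated ℓ x (Q.dualPoint σ c B x) (Q.blk k) := by
      by_contra hne
      exact hk (Finset.mem_filter.2 ⟨hB, hne⟩)
    exact hz.eq_zero_of_eliminated hn hℓ hdiff hscalar hc hc' hx hB hel rfl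
  · exact hz.1 k hB

end CompositeProblem

namespace CompositeProblem

variable {n p q : ℕ} {Q : CompositeProblem n p q}

/-! ### One proximal step -/

/-- The variance-reduced gradient at `xhat`, recentered at the solution `z`. -/
noncomputable def centeredGrad (Q : CompositeProblem n p q) (B : Finset (Fin q)) (i : Fin n)
    (x0 z xhat : EuclideanSpace ℝ (Fin p)) : EuclideanSpace ℝ (Fin p) :=
  Q.vrGrad B i x0 xhat - Q.restr B (Q.Dmul i (gradient Q.F z))

theorem centeredGrad_apply (Q : CompositeProblem n p q) (B : Finset (Fin q)) (i : Fin n)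
    (x0 z xhat : EuclideanSpace ℝ (Fin p)) (k : Fin p) :
    Q.centeredGrad B i x0 z xhat k = if Q.blk k ∈ B then
      gradient (Q.Fi i) xhat k - gradient (Q.Fi i) x0 k
        + (if Q.blk k ∈ Q.Psi i then Q.d (Q.blk k) * (gradient Q.F x0 k - gradient Q.F z k) else 0)
      else 0 := by
  simp only [centeredGrad, vrGrad, PiLp.sub_apply, restr_apply, PiLp.add_apply, Dmul_apply]
  split_ifs <;> ring

theorem d_nonneg (Q : CompositeProblem n p q) (j : Fin q) : 0 ≤ Q.d j := by
  unfold d; positivity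

theorem convexOn_lam_phi (Q : CompositeProblem n p q) (B : Finset (Fin q)) (i : Fin n) :
    ConvexOn ℝ Set.univ (fun z => Q.lam * Q.phi B i z) :=
  (Q.convexOn_weighted_blockReg (Q.Psi i ∩ B) Q.d Q.d_nonneg).smul Q.lam_pos.le

theorem lam_phi_nonneg (Q : CompositeProblem n p q) (B : Finset (Fin q)) (i : Fin n)
    (z : EuclideanSpace ℝ (Fin p)) : 0 ≤ Q.lam * Q.phi B i z :=
  mul_nonneg Q.lam_pos.le (Finset.sum_nonneg fun j _ => mul_nonneg (Q.d_nonneg j)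
    (Q.blockReg_nonneg j z))

theorem vrGrad_apply_eq_zero {B : Finset (Fin q)} {i : Fin n} {k : Fin p}
    (hk : Q.blk k ∉ Q.Psi i ∩ B) (x0 xhat : EuclideanSpace ℝ (Fin p)) :
    Q.vrGrad B i x0 xhat k = 0 := by
  simp only [vrGrad, restr_apply, PiLp.add_apply, PiLp.sub_apply, Dmul_apply]
  by_cases hB : Q.blk k ∈ B
  · have hP : Q.blk k ∉ Q.Psi i := fun h => hk (Finset.mem_inter.2 ⟨h, hB⟩)
    simp [hP, Q.gradient_Fi_apply_eq_zero hP]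
  · simp [hB]

/-- Off the active extended support both the gradient step and φ_i are trivial, so the proximal map
does not move the coordinate. This sparsity of the updates is what tames the overlaps. -/
theorem delta_apply_eq_zero {η : ℝ} (hη : 0 < η) {B : Finset (Fin q)} {i : Fin n} {k : Fin p}
    (hk : Q.blk k ∉ Q.Psi i ∩ B) (x0 xhat : EuclideanSpace ℝ (Fin p)) :
    Q.delta η B i x0 xhat k = 0 := by
  set x' := xhat - η • Q.vrGrad B i x0 xhat with hx'
  set z := prox η (fun z => Q.lam * Q.phi B i z) x' with hz
  have hin := prox_inner_le hη (Q.convexOn_lam_phi B i) (Q.lam_phi_nonneg B i) x'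
    -- The test point replaces coordinate `k` of the proximal point by that of `x'`; φ_i does not
    -- see the change, so the inequality reduces to (x'_k - z_k)² ≤ 0.
    (z + EuclideanSpace.single k (x' k - z k))
  rw [← hz, add_sub_cancel_left] at hin
  have hphi : Q.phi B i (z + EuclideanSpace.single k (x' k - z k)) = Q.phi B i z := by
    refine Finset.sum_congr rfl fun j hj => ?_
    congr 1
    refine Q.blockReg_congr fun k' hk' => ?_
    have : k' ≠ k := by
      rintro rfl
      exact hk (hk' ▸ hj)
    simp [this]
  rw [hphi, sub_self, mul_zero, inner_eq_sum, Finset.sum_eq_single k] at hin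
  · have h0 : (x' k - z k) * (x' k - z k) ≤ 0 := by simpa using hin
    have h1 : x' k - z k = 0 := mul_self_eq_zero.1 (le_antisymm h0 (mul_self_nonneg _))
    have h2 : x' k = xhat k := by
      simp [hx', vrGrad_apply_eq_zero hk]
    change (z - xhat) k = 0
    rw [PiLp.sub_apply, ← h2]
    linarith
  · intro k' _ hk'
    simp [hk']
  · simp

theorem supportedOn_delta {η : ℝ} (hη : 0 < η) (B : Finset (Fin q)) (i : Fin n)
    (x0 xhat : EuclideanSpace ℝ (Fin p)) : Q.SupportedOn B (Q.delta η B i x0 xhat) :=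
  fun _ hk => delta_apply_eq_zero hη (fun h => hk (Finset.mem_inter.1 h).2) x0 xhat

theorem IsSolution.reweighted_nonneg (hdiff : ∀ i, Differentiable ℝ (Q.f i)) {B : Finset (Fin q)}
    {z : EuclideanSpace ℝ (Fin p)} (hz : Q.IsSolution B z) (i : Fin n)
    (w : EuclideanSpace ℝ (Fin p)) :
    0 ≤ inner ℝ (Q.restr B (Q.Dmul i (gradient Q.F z))) (w - z)
      + (Q.lam * Q.phi B i w - Q.lam * Q.phi B i z) := by
  have h : 0 ≤ ∑ j ∈ Q.Psi i ∩ B, Q.d j *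
      (∑ k, (if Q.blk k = j then gradient Q.F z k * (w k - z k) else 0)
        + Q.lam * (Q.blockReg j w - Q.blockReg j z)) :=
    Finset.sum_nonneg fun j hj => mul_nonneg (Q.d_nonneg j)
      (hz.block_nonneg hdiff (Finset.mem_inter.1 hj).2 w)
  convert h using 1
  simp only [mul_add, Finset.sum_add_distrib]
  congr 1
  · rw [inner_eq_sum]
    simp only [Finset.mul_sum]
    rw [Finset.sum_comm]
    refine Finset.sum_congr rfl fun k _ => ?_
    simp only [mul_ite, mul_zero, Finset.sum_ite_eq, Finset.mem_inter, restr_apply, Dmul_apply,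
      PiLp.sub_apply]
    by_cases h1 : Q.blk k ∈ B <;> by_cases h2 : Q.blk k ∈ Q.Psi i <;> simp [h1, h2, mul_assoc]
  · simp only [phi, Finset.mul_sum]
    rw [← Finset.sum_sub_distrib]
    exact Finset.sum_congr rfl fun j _ => by ring

/-- Adding the proximal inequality tested at z to the reweighted optimality of z tested at the
proximal point cancels φ_i and D_i∇F(z), leaving ⟨δ + ηV, x̂ - z + δ⟩ ≤ 0. -/
theorem IsSolution.two_inner_delta_le (hdiff : ∀ i, Differentiable ℝ (Q.f i)) {η : ℝ} (hη : 0 < η)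
    {B : Finset (Fin q)} {z : EuclideanSpace ℝ (Fin p)} (hz : Q.IsSolution B z) (i : Fin n)
    (x0 xhat : EuclideanSpace ℝ (Fin p)) :
    2 * inner ℝ (Q.delta η B i x0 xhat) (xhat - z)
      ≤ -(3 / 2) * ‖Q.delta η B i x0 xhat‖ ^ 2
        - 2 * η * inner ℝ (Q.centeredGrad B i x0 z xhat) (xhat - z)
        + 2 * η ^ 2 * ‖Q.centeredGrad B i x0 z xhat‖ ^ 2 := by
  set x' := xhat - η • Q.vrGrad B i x0 xhat with hx'
  set y := prox η (fun z => Q.lam * Q.phi B i z) x' with hy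
  set δ := Q.delta η B i x0 xhat with hδ
  set D := Q.restr B (Q.Dmul i (gradient Q.F z)) with hD
  set V := Q.centeredGrad B i x0 z xhat with hV
  have hyd : y = xhat + δ := by
    simp only [hδ, delta, ← hx', ← hy]; abel
  have h1 := prox_inner_le hη (Q.convexOn_lam_phi B i) (Q.lam_phi_nonneg B i) x' z
  rw [← hy] at h1
  have h2 := mul_nonneg hη.le (hz.reweighted_nonneg hdiff i y)
  have hx'' : x' = xhat - η • (V + D) := by
    rw [hx', hV, centeredGrad, hD]; congr 2; abel
  have e1 : x' - y = -(δ + η • (V + D)) := by rw [hx'', hyd]; abel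
  have e2 : z - y = -((xhat - z) + δ) := by rw [hyd]; abel
  have e3 : y - z = (xhat - z) + δ := by rw [hyd]; abel
  rw [e1, e2, inner_neg_neg] at h1
  rw [e3] at h2
  simp only [inner_add_left, inner_add_right, inner_smul_left, conj_trivial,
    real_inner_self_eq_norm_sq] at h1 h2
  -- Young for the remaining cross term: -2η⟨V, δ⟩ ≤ 2η²‖V‖² + ‖δ‖²/2, which turns -2‖δ‖² into
  -- -(3/2)‖δ‖².
  have h3 : 0 ≤ ‖(2 * η) • V + δ‖ ^ 2 := sq_nonneg _
  rw [norm_add_sq_real, norm_smul, mul_pow, inner_smul_left, Real.norm_eq_abs, sq_abs,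
    conj_trivial] at h3
  nlinarith

theorem IsSolution.norm_step_le (hdiff : ∀ i, Differentiable ℝ (Q.f i)) {η : ℝ} (hη : 0 < η)
    {B : Finset (Fin q)} {z : EuclideanSpace ℝ (Fin p)} (hz : Q.IsSolution B z) (i : Fin n)
    (x0 x xhat : EuclideanSpace ℝ (Fin p)) :
    ‖x + Q.delta η B i x0 xhat - z‖ ^ 2 ≤ ‖x - z‖ ^ 2
      - 1 / 2 * ‖Q.delta η B i x0 xhat‖ ^ 2
      - 2 * η * inner ℝ (Q.centeredGrad B i x0 z xhat) (xhat - z)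
      + 2 * η ^ 2 * ‖Q.centeredGrad B i x0 z xhat‖ ^ 2
      + 2 * inner ℝ (Q.delta η B i x0 xhat) (x - xhat) := by
  have h := hz.two_inner_delta_le hdiff hη i x0 xhat
  set δ := Q.delta η B i x0 xhat
  have e : x + δ - z = (x - z) + δ := by abel
  have e2 : x - z = (xhat - z) + (x - xhat) := by abel
  rw [e, norm_add_sq_real]
  have e3 : inner ℝ (x - z) δ = inner ℝ δ (xhat - z) + inner ℝ δ (x - xhat) := by
    rw [real_inner_comm, ← inner_add_right, ← e2]
  rw [e3]
  linarith

/-! ### Averages over the samples -/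

theorem occ_eq_sum (Q : CompositeProblem n p q) (j : Fin q) :
    ∑ i, (if j ∈ Q.Psi i then (1 : ℝ) else 0) = Q.occ j := by
  simp [occ]

theorem sum_gradient_Fi (hn : 0 < n) (hdiff : ∀ i, Differentiable ℝ (Q.f i))
    (x : EuclideanSpace ℝ (Fin p)) (k : Fin p) :
    ∑ i, gradient (Q.Fi i) x k = n * gradient Q.F x k := by
  have : (n : ℝ) ≠ 0 := Nat.cast_ne_zero.2 hn.ne'
  rw [gradient_F_apply Q hdiff]
  field_simp

/-- Unbiasedness: a block occurs in n_G samples with weight n/n_G, so the correction terms average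
to ∇F(x⁰) - ∇F(z). The restriction to the active set is harmless against a vector supported there.
-/
theorem sum_inner_centeredGrad (hn : 0 < n) (hdiff : ∀ i, Differentiable ℝ (Q.f i))
    (hocc : ∀ k, Q.occ (Q.blk k) ≠ 0) {B : Finset (Fin q)} (x0 z xhat : EuclideanSpace ℝ (Fin p))
    {y : EuclideanSpace ℝ (Fin p)} (hy : Q.SupportedOn B y) :
    ∑ i, inner ℝ (Q.centeredGrad B i x0 z xhat) y
      = n * inner ℝ (gradient Q.F xhat - gradient Q.F z) y := by
  simp only [inner_eq_sum]
  rw [Finset.sum_comm, Finset.mul_sum]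
  refine Finset.sum_congr rfl fun k _ => ?_
  rw [← Finset.sum_mul, ← mul_assoc]
  by_cases hk : Q.blk k ∈ B
  · congr 1
    simp only [centeredGrad_apply, hk, if_true]
    rw [Finset.sum_add_distrib, Finset.sum_sub_distrib, sum_gradient_Fi hn hdiff,
      sum_gradient_Fi hn hdiff]
    have e : ∀ i : Fin n, (if Q.blk k ∈ Q.Psi i then
        Q.d (Q.blk k) * (gradient Q.F x0 k - gradient Q.F z k) else 0)
        = (if Q.blk k ∈ Q.Psi i then (1 : ℝ) else 0)
          * (Q.d (Q.blk k) * (gradient Q.F x0 k - gradient Q.F z k)) := fun i => by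
      split_ifs <;> simp
    simp only [e]
    rw [← Finset.sum_mul, occ_eq_sum, d]
    have : (Q.occ (Q.blk k) : ℝ) ≠ 0 := Nat.cast_ne_zero.2 (hocc k)
    simp only [PiLp.sub_apply]
    field_simp
    ring
  · simp [hy k hk]

/-- `N / m * c` is the mean of `a` over the indices in `s`, so this is variance ≤ second moment on
`s`. -/
theorem sum_sq_reweighted_sub_le {ι : Type*} [Fintype ι] (s : ι → Prop) [DecidablePred s]
    {a : ι → ℝ} {N m c : ℝ} (hm : m ≠ 0) (hm0 : 0 ≤ m)
    (hs : ∑ i, (if s i then (1 : ℝ) else 0) = m)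
    (ha : ∀ i, ¬ s i → a i = 0) (hsum : ∑ i, a i = N * c) :
    ∑ i, ((if s i then N / m * c else 0) - a i) ^ 2 ≤ ∑ i, a i ^ 2 := by
  have e : ∀ i, ((if s i then N / m * c else 0) - a i) ^ 2
      = a i ^ 2 + (if s i then (1 : ℝ) else 0) * (N / m * c) ^ 2 - 2 * (N / m * c) * a i := by
    intro i
    by_cases h : s i
    · simp only [h, if_true]; ring
    · simp [h, ha i h]
  simp only [e]
  rw [Finset.sum_sub_distrib, Finset.sum_add_distrib, ← Finset.sum_mul, hs, ← Finset.mul_sum, hsum]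
  have e2 : m * (N / m * c) ^ 2 - 2 * (N / m * c) * (N * c) = - (N ^ 2 * c ^ 2 / m) := by
    field_simp; ring
  have : 0 ≤ N ^ 2 * c ^ 2 / m := by positivity
  linarith

/-- V is the gradient difference between x̂ and z plus the error `b i` of the control variate. The
latter is a deviation from a reweighted mean, so its second moment is at most that of the
differences between x⁰ and z; smoothness bounds both. -/
theorem sum_norm_centeredGrad_sq_le {L : ℝ} (hn : 0 < n)
    (hdiff : ∀ i, Differentiable ℝ (Q.f i))
    (hsmooth : ∀ i, ∀ x x' : EuclideanSpace ℝ (Fin p),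
      ‖gradient (Q.Fi i) x - gradient (Q.Fi i) x'‖ ≤ L * ‖x - x'‖)
    (hocc : ∀ k, Q.occ (Q.blk k) ≠ 0) (B : Finset (Fin q))
    (x0 z xhat : EuclideanSpace ℝ (Fin p)) :
    ∑ i, ‖Q.centeredGrad B i x0 z xhat‖ ^ 2
      ≤ n * (2 * L ^ 2 * (‖xhat - z‖ ^ 2 + ‖x0 - z‖ ^ 2)) := by
  set b : Fin n → EuclideanSpace ℝ (Fin p) := fun i =>
    Q.Dmul i (gradient Q.F x0 - gradient Q.F z) - (gradient (Q.Fi i) x0 - gradient (Q.Fi i) z)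
    with hb
  have hL : ∀ i x, ‖gradient (Q.Fi i) x - gradient (Q.Fi i) z‖ ^ 2 ≤ L ^ 2 * ‖x - z‖ ^ 2 := by
    intro i x
    rw [← mul_pow]
    exact pow_le_pow_left₀ (norm_nonneg _) (hsmooth i x z) 2
  have h1 : ∀ i, ‖Q.centeredGrad B i x0 z xhat‖ ^ 2
      ≤ 2 * ‖gradient (Q.Fi i) xhat - gradient (Q.Fi i) z‖ ^ 2 + 2 * ‖b i‖ ^ 2 := by
    intro i
    have e : Q.centeredGrad B i x0 z xhat
        = Q.restr B ((gradient (Q.Fi i) xhat - gradient (Q.Fi i) z) + b i) := by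
      ext k
      simp only [centeredGrad_apply, restr_apply, hb, PiLp.add_apply, PiLp.sub_apply, Dmul_apply]
      split_ifs <;> ring
    rw [e]
    refine (Q.norm_restr_sq_le B _).trans ?_
    have := parallelogram_law_with_norm ℝ (gradient (Q.Fi i) xhat - gradient (Q.Fi i) z) (b i)
    have h0 := sq_nonneg ‖gradient (Q.Fi i) xhat - gradient (Q.Fi i) z - b i‖
    nlinarith
  have h2 : ∑ i, ‖b i‖ ^ 2 ≤ ∑ i, ‖gradient (Q.Fi i) x0 - gradient (Q.Fi i) z‖ ^ 2 := by
    simp only [norm_sq_eq_sum]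
    rw [Finset.sum_comm, Finset.sum_comm (s := (Finset.univ : Finset (Fin n)))]
    refine Finset.sum_le_sum fun k _ => ?_
    refine sum_sq_reweighted_sub_le (fun i => Q.blk k ∈ Q.Psi i) (m := Q.occ (Q.blk k))
      (a := fun i => gradient (Q.Fi i) x0 k - gradient (Q.Fi i) z k)
      (Nat.cast_ne_zero.2 (hocc k)) (Nat.cast_nonneg _)
      (Q.occ_eq_sum _) ?_ ?_
    · intro i hi
      simp [Q.gradient_Fi_apply_eq_zero hi]
    · rw [Finset.sum_sub_distrib, sum_gradient_Fi hn hdiff, sum_gradient_Fi hn hdiff]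
      simp only [PiLp.sub_apply]
      ring
  calc ∑ i, ‖Q.centeredGrad B i x0 z xhat‖ ^ 2
      ≤ ∑ i, (2 * ‖gradient (Q.Fi i) xhat - gradient (Q.Fi i) z‖ ^ 2 + 2 * ‖b i‖ ^ 2) :=
        Finset.sum_le_sum fun i _ => h1 i
    _ = ∑ i, 2 * ‖gradient (Q.Fi i) xhat - gradient (Q.Fi i) z‖ ^ 2 + 2 * ∑ i, ‖b i‖ ^ 2 := by
        rw [Finset.sum_add_distrib, ← Finset.mul_sum, ← Finset.mul_sum]
    _ ≤ ∑ i, 2 * ‖gradient (Q.Fi i) xhat - gradient (Q.Fi i) z‖ ^ 2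
        + 2 * ∑ i, ‖gradient (Q.Fi i) x0 - gradient (Q.Fi i) z‖ ^ 2 := by linarith
    _ ≤ ∑ _i : Fin n, 2 * (L ^ 2 * ‖xhat - z‖ ^ 2) + 2 * ∑ _i : Fin n, L ^ 2 * ‖x0 - z‖ ^ 2 := by
        gcongr with i _ i _
        · exact hL i xhat
        · exact hL i x0
    _ = n * (2 * L ^ 2 * (‖xhat - z‖ ^ 2 + ‖x0 - z‖ ^ 2)) := by
        simp; ring

/-! ### Consequences of strong convexity -/

theorem strong_monotone {μ : ℝ}
    (hconv : ∀ x x' : EuclideanSpace ℝ (Fin p),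
      Q.F x + inner ℝ (gradient Q.F x) (x' - x) + μ / 2 * ‖x' - x‖ ^ 2 ≤ Q.F x')
    (x z : EuclideanSpace ℝ (Fin p)) :
    μ * ‖x - z‖ ^ 2 ≤ inner ℝ (gradient Q.F x - gradient Q.F z) (x - z) := by
  have h1 := hconv x z
  have h2 := hconv z x
  rw [← neg_sub x z, inner_neg_right, norm_neg] at h1
  rw [inner_sub_left]
  linarith

/-- A coordinate whose block no sample touches would make F flat in that direction, against strong
convexity. Hence the weights n/n_G involve no division by zero. -/
theorem occ_ne_zero {μ : ℝ} (hμ : 0 < μ) (hdiff : ∀ i, Differentiable ℝ (Q.f i))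
    (hconv : ∀ x x' : EuclideanSpace ℝ (Fin p),
      Q.F x + inner ℝ (gradient Q.F x) (x' - x) + μ / 2 * ‖x' - x‖ ^ 2 ≤ Q.F x')
    (k : Fin p) : Q.occ (Q.blk k) ≠ 0 := by
  intro h
  have h0 : ∀ x, gradient Q.F x k = 0 := by
    intro x
    rw [gradient_F_apply Q hdiff, Finset.sum_eq_zero, mul_zero]
    intro i _
    refine Q.gradient_Fi_apply_eq_zero (fun hi => ?_) x
    rw [occ, Finset.card_eq_zero, Finset.filter_eq_empty_iff] at h
    exact h (Finset.mem_univ i) hi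
  have := strong_monotone hconv (EuclideanSpace.single k 1) 0
  rw [inner_eq_sum, Finset.sum_eq_single k] at this
  · simp [h0] at this
    linarith
  · intro k' _ hk'
    simp [hk']
  · simp

theorem strong_convexity_le_smoothness {μ L : ℝ} (hn : 0 < n)
    (hdiff : ∀ i, Differentiable ℝ (Q.f i))
    (hconv : ∀ x x' : EuclideanSpace ℝ (Fin p),
      Q.F x + inner ℝ (gradient Q.F x) (x' - x) + μ / 2 * ‖x' - x‖ ^ 2 ≤ Q.F x')
    (hsmooth : ∀ i, ∀ x x' : EuclideanSpace ℝ (Fin p),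
      ‖gradient (Q.Fi i) x - gradient (Q.Fi i) x'‖ ≤ L * ‖x - x'‖)
    (k : Fin p) : μ ≤ L := by
  set e : EuclideanSpace ℝ (Fin p) := EuclideanSpace.single k 1
  have h1 := strong_monotone hconv e 0
  have he : ‖e‖ = 1 := by simp [e]
  have h2 : ‖gradient Q.F e - gradient Q.F 0‖ ≤ L := by
    rw [gradient_F Q hdiff, gradient_F Q hdiff, ← smul_sub, ← Finset.sum_sub_distrib, norm_smul]
    have h3 : ‖∑ i, (gradient (Q.Fi i) e - gradient (Q.Fi i) 0)‖ ≤ n * L := by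
      refine (norm_sum_le _ _).trans ?_
      calc ∑ i, ‖gradient (Q.Fi i) e - gradient (Q.Fi i) 0‖ ≤ ∑ _i : Fin n, L :=
            Finset.sum_le_sum fun i _ => by simpa [he] using hsmooth i e 0
        _ = n * L := by simp
    have hn' : (0 : ℝ) < n := Nat.cast_pos.2 hn
    rw [Real.norm_of_nonneg (by positivity), one_div, ← div_eq_inv_mul, div_le_iff₀ hn']
    linarith
  have h3 := real_inner_le_norm (gradient Q.F e - gradient Q.F 0) (e - 0)
  rw [sub_zero, he] at h1 h3
  linarith

/-! ### Sparsity and overlapping supports -/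

theorem occ_div_le_Delta (Q : CompositeProblem n p q) (j : Fin q) :
    (Q.occ j : ℝ) / n ≤ Q.Delta :=
  le_ciSup (f := fun j => (Q.occ j : ℝ) / n) (Set.finite_range _).bddAbove j

theorem Delta_pos (hn : 0 < n) {k : Fin p} (hocc : Q.occ (Q.blk k) ≠ 0) : 0 < Q.Delta := by
  refine lt_of_lt_of_le ?_ (Q.occ_div_le_Delta (Q.blk k))
  have : 0 < Q.occ (Q.blk k) := Nat.pos_of_ne_zero hocc
  positivity

/-- The inner product of the coordinatewise absolute values. -/
def absInner (x y : EuclideanSpace ℝ (Fin p)) : ℝ := ∑ k, |x k| * |y k|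

theorem absInner_comm (x y : EuclideanSpace ℝ (Fin p)) : absInner x y = absInner y x :=
  Finset.sum_congr rfl fun _ _ => mul_comm _ _

theorem absInner_self (x : EuclideanSpace ℝ (Fin p)) : absInner x x = ‖x‖ ^ 2 := by
  rw [norm_sq_eq_sum]
  exact Finset.sum_congr rfl fun k _ => by rw [abs_mul_abs_self, sq]

/-- Young's inequality on the extended support of the sample of the second update. -/
theorem absInner_delta_le {η ε : ℝ} (hη : 0 < η) (hε : 0 < ε) (B : Finset (Fin q)) (i : Fin n)
    (x0 xhat y : EuclideanSpace ℝ (Fin p)) :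
    absInner y (Q.delta η B i x0 xhat)
      ≤ 1 / (2 * ε) * ‖Q.restr (Q.Psi i) y‖ ^ 2 + ε / 2 * ‖Q.delta η B i x0 xhat‖ ^ 2 := by
  rw [norm_sq_eq_sum, norm_sq_eq_sum, Finset.mul_sum, Finset.mul_sum, ← Finset.sum_add_distrib]
  refine Finset.sum_le_sum fun k _ => ?_
  by_cases hk : Q.blk k ∈ Q.Psi i
  · rw [restr_apply, if_pos hk, ← sq_abs (y k), ← sq_abs (Q.delta η B i x0 xhat k)]
    set a := |y k|
    set b := |Q.delta η B i x0 xhat k|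
    have h : 0 ≤ 1 / (2 * ε) * (a - ε * b) ^ 2 := by positivity
    have e : 1 / (2 * ε) * (a - ε * b) ^ 2
        = 1 / (2 * ε) * a ^ 2 + ε / 2 * b ^ 2 - a * b := by field_simp; ring
    linarith
  · rw [delta_apply_eq_zero hη (fun h => hk (Finset.mem_inter.1 h).1)]
    simp [restr_apply, hk]

theorem sum_norm_restr_Psi_sq_le (hn : 0 < n) (y : EuclideanSpace ℝ (Fin p)) :
    ∑ i, ‖Q.restr (Q.Psi i) y‖ ^ 2 ≤ n * (Q.Delta * ‖y‖ ^ 2) := by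
  have hn' : (0 : ℝ) < n := Nat.cast_pos.2 hn
  simp only [norm_sq_eq_sum]
  rw [Finset.sum_comm, Finset.mul_sum, Finset.mul_sum]
  refine Finset.sum_le_sum fun k _ => ?_
  have e : ∀ i : Fin n, Q.restr (Q.Psi i) y k ^ 2
      = (if Q.blk k ∈ Q.Psi i then (1 : ℝ) else 0) * y k ^ 2 := fun i => by
    rw [restr_apply]; split_ifs <;> simp
  simp only [e]
  rw [← Finset.sum_mul, occ_eq_sum, ← mul_assoc]
  refine mul_le_mul_of_nonneg_right ?_ (sq_nonneg _)
  have := Q.occ_div_le_Delta (Q.blk k)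
  rw [div_le_iff₀ hn'] at this
  linarith

end CompositeProblem

/-! ### Measurable functions with finitely many values -/

/-- `f` takes finitely many values, each of them on an `m`-measurable set. -/
structure FinitelyMeasurable {W α : Type*} (m : MeasurableSpace W) (f : W → α) : Prop where
  finite_range : (Set.range f).Finite
  measurableSet_fiber : ∀ y, MeasurableSet[m] (f ⁻¹' {y})

namespace FinitelyMeasurable

variable {W α β γ : Type*} {m m' : MeasurableSpace W}

theorem const (a : α) : FinitelyMeasurable m (fun _ : W => a) where
  finite_range := (Set.finite_singleton a).subset (Set.range_subset_iff.2 fun _ => rfl)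
  measurableSet_fiber _ := by
    by_cases h : a = ‹α› <;> simp [h, Set.preimage]

theorem mono {f : W → α} (hf : FinitelyMeasurable m f) (h : m ≤ m') : FinitelyMeasurable m' f :=
  ⟨hf.1, fun y => h _ (hf.2 y)⟩

/-- Finite range makes preimages of arbitrary sets measurable, so composition with any map is
allowed; neither the chosen proximal points nor the screening rule need a measurability proof. -/
theorem measurableSet_preimage {f : W → α} (hf : FinitelyMeasurable m f) (s : Set α) :
    MeasurableSet[m] (f ⁻¹' s) := by
  have : f ⁻¹' s = ⋃ y ∈ (Set.range f ∩ s), f ⁻¹' {y} := by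
    ext ω; simp
  rw [this]
  exact (hf.1.subset Set.inter_subset_left).measurableSet_biUnion fun y _ => hf.2 y

theorem comp {f : W → α} (hf : FinitelyMeasurable m f) (g : α → β) :
    FinitelyMeasurable m (fun ω => g (f ω)) where
  finite_range := by
    have : Set.range (fun ω => g (f ω)) = g '' Set.range f := Set.range_comp g f
    rw [this]
    exact hf.1.image g
  measurableSet_fiber y := hf.measurableSet_preimage (g ⁻¹' {y})

theorem prodMk {f : W → α} {g : W → β} (hf : FinitelyMeasurable m f)
    (hg : FinitelyMeasurable m g) : FinitelyMeasurable m (fun ω => (f ω, g ω)) where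
  finite_range := (hf.1.prod hg.1).subset (Set.range_subset_iff.2 fun ω => ⟨⟨ω, rfl⟩, ⟨ω, rfl⟩⟩)
  measurableSet_fiber y := by
    have : (fun ω => (f ω, g ω)) ⁻¹' {y} = f ⁻¹' {y.1} ∩ g ⁻¹' {y.2} := by
      ext ω; simp [Prod.ext_iff]
    rw [this]
    exact (hf.2 _).inter (hg.2 _)

theorem comp₂ {f : W → α} {g : W → β} (hf : FinitelyMeasurable m f)
    (hg : FinitelyMeasurable m g) (φ : α → β → γ) :
    FinitelyMeasurable m (fun ω => φ (f ω) (g ω)) :=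
  (hf.prodMk hg).comp fun x => φ x.1 x.2

theorem of_finite_range {f : W → α} (hf : (Set.range f).Finite) :
    FinitelyMeasurable (⊤ : MeasurableSpace W) f := ⟨hf, fun _ => trivial⟩

theorem finset_sum {ι : Type*} [AddCommMonoid α] (s : Finset ι) {f : ι → W → α}
    (hf : ∀ i ∈ s, FinitelyMeasurable m (f i)) :
    FinitelyMeasurable m (fun ω => ∑ i ∈ s, f i ω) := by
  classical
  induction s using Finset.induction_on with
  | empty => simpa using const (0 : α)
  | insert a s ha ih =>
    simp only [Finset.sum_insert ha]
    exact (hf a (Finset.mem_insert_self a s)).comp₂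
      (ih fun i hi => hf i (Finset.mem_insert_of_mem hi)) (· + ·)

theorem measurable [MeasurableSpace α] {f : W → α} (hf : FinitelyMeasurable m f) :
    Measurable[m] f := fun s _ => hf.measurableSet_preimage s

theorem integrable {mW : MeasurableSpace W} {Pr : Measure W} [IsFiniteMeasure Pr] {f : W → ℝ}
    (hf : FinitelyMeasurable m f) (h : m ≤ mW) : Integrable f Pr :=
  SimpleFunc.integrable_of_isFiniteMeasure ⟨f, (hf.mono h).2, hf.1⟩

end FinitelyMeasurable

/-- Averaging over a uniform sample that is independent of the rest. -/
theorem integral_uniform_sample {W : Type*} {m : MeasurableSpace W} {mW : MeasurableSpace W}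
    {Pr : Measure W} [IsProbabilityMeasure Pr] {n : ℕ} (hm : m ≤ mW) {X : W → Fin n}
    (hX : Measurable X) (hunif : ∀ i, Pr {ω | X ω = i} = (n : ENNReal)⁻¹)
    (hind : Indep (MeasurableSpace.comap X inferInstance) m Pr) {G : W → Fin n → ℝ}
    (hG : ∀ i, FinitelyMeasurable m (fun ω => G ω i)) :
    ∫ ω, G ω (X ω) ∂Pr = (1 / (n : ℝ)) * ∫ ω, ∑ i, G ω i ∂Pr := by
  have hset : ∀ i, MeasurableSet {ω | X ω = i} := fun i => hX (measurableSet_singleton i)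
  have hI : ∀ i, Integrable (fun ω => G ω i) Pr := fun i => (hG i).integrable hm
  -- Splitting over the values of `X` leaves products of independent factors, and no conditional
  -- expectation is needed.
  have e : ∀ ω, G ω (X ω) = ∑ i, Set.indicator {ω | X ω = i} (fun _ => (1 : ℝ)) ω * G ω i := by
    intro ω
    rw [Finset.sum_eq_single (X ω)]
    · simp
    · intro i _ hi
      simp [Set.indicator, hi.symm]
    · simp
  have hmeas : ∀ i, Measurable (Set.indicator {ω | X ω = i} (fun _ => (1 : ℝ))) := fun i =>
    measurable_const.indicator (hset i)
  have hterm : ∀ i, ∫ ω, Set.indicator {ω | X ω = i} (fun _ => (1 : ℝ)) ω * G ω i ∂Pr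
      = (1 / (n : ℝ)) * ∫ ω, G ω i ∂Pr := by
    intro i
    have hif : IndepFun (Set.indicator {ω | X ω = i} (fun _ => (1 : ℝ))) (fun ω => G ω i) Pr := by
      rw [IndepFun_iff_Indep]
      refine indep_of_indep_of_le_left (indep_of_indep_of_le_right hind ?_) ?_
      · exact (hG i).measurable.comap_le
      · refine Measurable.comap_le ?_
        exact Measurable.indicator measurable_const ⟨{i}, measurableSet_singleton i, rfl⟩
    rw [hif.integral_fun_mul_eq_mul_integral (hmeas i).aestronglyMeasurable
      (hI i).aestronglyMeasurable, integral_indicator_const _ (hset i)]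
    simp [Measure.real, hunif]
  simp only [e]
  rw [integral_finsetSum, integral_finsetSum _ fun i _ => hI i, Finset.mul_sum]
  · exact Finset.sum_congr rfl fun i _ => hterm i
  · intro i _
    refine (hI i).bdd_mul (c := 1) (hmeas i).aestronglyMeasurable
      (Filter.Eventually.of_forall fun ω => ?_)
    by_cases h : X ω = i <;> simp [h]

/-! ### A linear recursion with a window of past terms -/

/-- Double counting: an index `u` lies only in the windows of t = u+1, …, u+τ. -/
theorem sum_window_le {h : ℕ → ℝ} (hh : ∀ u, 0 ≤ h u) (τ K : ℕ) :
    ∑ t ∈ Finset.range K, ∑ u ∈ Finset.Ico (t - τ) t, h u ≤ τ * ∑ u ∈ Finset.range K, h u := by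
  have e : ∀ t ∈ Finset.range K, ∑ u ∈ Finset.Ico (t - τ) t, h u
      = ∑ u ∈ Finset.range K, if u ∈ Finset.Ico (t - τ) t then h u else 0 := by
    intro t ht
    rw [← Finset.sum_filter]
    congr 1
    ext u
    simp only [Finset.mem_range, Finset.mem_filter, Finset.mem_Ico] at ht ⊢
    omega
  rw [Finset.sum_congr rfl e, Finset.sum_comm, Finset.mul_sum]
  refine Finset.sum_le_sum fun u _ => ?_
  rw [← Finset.sum_filter, Finset.sum_const, nsmul_eq_mul]
  refine mul_le_mul_of_nonneg_right ?_ (hh u)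
  have hsub : Finset.filter (fun t => u ∈ Finset.Ico (t - τ) t) (Finset.range K)
      ⊆ Finset.Ioc u (u + τ) := by
    intro t ht
    simp only [Finset.mem_range, Finset.mem_filter, Finset.mem_Ico, Finset.mem_Ioc] at ht ⊢
    omega
  have := Finset.card_le_card hsub
  rw [Nat.card_Ioc, Nat.add_sub_cancel_left] at this
  exact_mod_cast this

/-- Unrolling gives step t the weight (1 - r)^{-(t+1)}. Across a window these weights vary by a
factor at most 10/9, as rτ ≤ 1/10, and each D_u lies in at most τ windows; so the window terms cost
at most (10/9)βτ ≤ γ per weighted D_u and are absorbed. -/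
theorem le_of_window_recursion {a D : ℕ → ℝ} {r e γ β : ℝ} {τ K : ℕ} (hr : 0 < r) (hr1 : r < 1)
    (hrτ : r * τ ≤ 1 / 10) (he : 0 ≤ e) (hβ : 0 ≤ β) (hβγ : β * τ ≤ 9 / 10 * γ)
    (hD : ∀ t, 0 ≤ D t)
    (hrec : ∀ t < K, a (t + 1) ≤ (1 - r) * a t + e - γ * D t
      + β * ∑ u ∈ Finset.Ico (t - τ) t, D u) :
    a K ≤ (1 - r) ^ K * a 0 + e / r := by
  set ρ := 1 - r with hρ
  have hρ0 : 0 < ρ := by linarith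
  set w : ℕ → ℝ := fun t => (ρ⁻¹) ^ (t + 1) with hw
  have hw0 : ∀ t, 0 < w t := fun t => by positivity
  have hone : 1 ≤ ρ⁻¹ := (one_le_inv₀ hρ0).2 (by linarith)
  have hmain : ∀ m ≤ K, a m ≤ ρ ^ m * (a 0 - ∑ t ∈ Finset.range m,
      w t * (γ * D t - β * ∑ u ∈ Finset.Ico (t - τ) t, D u)) + e / r := by
    intro m
    induction m with
    | zero => intro _; simp; positivity
    | succ m ih =>
      intro hm
      have h1 := hrec m hm
      have h2 := mul_le_mul_of_nonneg_left (ih (Nat.le_of_succ_le hm)) hρ0.le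
      rw [Finset.sum_range_succ]
      have e1 : ρ ^ (m + 1) * w m = 1 := by
        rw [hw]; simp only; rw [← mul_pow, mul_inv_cancel₀ hρ0.ne', one_pow]
      have e2 : ρ * (e / r) + e = e / r := by
        rw [hρ]; field_simp; ring
      set c := γ * D m - β * ∑ u ∈ Finset.Ico (m - τ) m, D u
      set Z := ∑ t ∈ Finset.range m, w t * (γ * D t - β * ∑ u ∈ Finset.Ico (t - τ) t, D u)
      have e3 : ρ ^ (m + 1) * (a 0 - (Z + w m * c)) + e / r
          = ρ * (ρ ^ m * (a 0 - Z)) - (ρ ^ (m + 1) * w m) * c + e / r := by ring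
      rw [e3, e1]
      linarith
  -- Bernoulli: (1 - r)^τ ≥ 1 - rτ.
  have hbern : 9 / 10 ≤ ρ ^ τ := by
    have := one_add_mul_le_pow (a := -r) (by linarith) τ
    have e : 1 + -r = ρ := by rw [hρ]; ring
    rw [e] at this
    nlinarith
  have hwin : ∀ t, ∀ u ∈ Finset.Ico (t - τ) t, w t * D u ≤ 10 / 9 * (w u * D u) := by
    intro t u hu
    rw [← mul_assoc]
    refine mul_le_mul_of_nonneg_right ?_ (hD u)
    rw [Finset.mem_Ico] at hu
    have h1 : w t ≤ w u * (ρ⁻¹) ^ τ := by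
      rw [hw]; simp only; rw [← pow_add]
      exact pow_le_pow_right₀ hone (by omega)
    have h2 : (ρ⁻¹) ^ τ ≤ 10 / 9 := by
      rw [inv_pow]
      refine inv_le_of_inv_le₀ (by norm_num) ?_
      norm_num; linarith
    have h3 := mul_le_mul_of_nonneg_left h2 (hw0 u).le
    linarith
  have hZ : 0 ≤ ∑ t ∈ Finset.range K,
      w t * (γ * D t - β * ∑ u ∈ Finset.Ico (t - τ) t, D u) := by
    have h1 : ∑ t ∈ Finset.range K, w t * ∑ u ∈ Finset.Ico (t - τ) t, D u
        ≤ 10 / 9 * (τ * ∑ u ∈ Finset.range K, w u * D u) := by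
      calc _ ≤ ∑ t ∈ Finset.range K, ∑ u ∈ Finset.Ico (t - τ) t, 10 / 9 * (w u * D u) := by
            refine Finset.sum_le_sum fun t _ => ?_
            rw [Finset.mul_sum]
            exact Finset.sum_le_sum (hwin t)
        _ = 10 / 9 * ∑ t ∈ Finset.range K, ∑ u ∈ Finset.Ico (t - τ) t, w u * D u := by
            simp only [Finset.mul_sum]
        _ ≤ _ := mul_le_mul_of_nonneg_left
            (sum_window_le (fun u => mul_nonneg (hw0 u).le (hD u)) τ K) (by norm_num)
    have e1 : ∑ t ∈ Finset.range K, w t * (γ * D t - β * ∑ u ∈ Finset.Ico (t - τ) t, D u)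
        = γ * ∑ t ∈ Finset.range K, w t * D t
          - β * ∑ t ∈ Finset.range K, w t * ∑ u ∈ Finset.Ico (t - τ) t, D u := by
      rw [Finset.mul_sum, Finset.mul_sum, ← Finset.sum_sub_distrib]
      exact Finset.sum_congr rfl fun t _ => by ring
    rw [e1]
    have hP : 0 ≤ ∑ t ∈ Finset.range K, w t * D t :=
      Finset.sum_nonneg fun t _ => mul_nonneg (hw0 t).le (hD t)
    have h2 := mul_le_mul_of_nonneg_left h1 hβ
    have h3 := mul_le_mul_of_nonneg_right hβγ hP
    nlinarith
  refine (hmain K le_rfl).trans ?_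
  have := mul_nonneg (pow_nonneg hρ0.le K) hZ
  nlinarith

namespace CompositeProblem

namespace ShaDDSS

variable {n p q : ℕ} {Q : CompositeProblem n p q} {σ c ℓ η : ℝ} {τ K S : ℕ}
  {x₀ : EuclideanSpace ℝ (Fin p)} {W : Type*} [mW : MeasurableSpace W] {Pr : Measure W}
  (R : Q.ShaDDSS σ c ℓ η τ K S x₀ Pr)

/-- The update of inner iteration `t` of outer loop `s`. -/
noncomputable def upd (s t : ℕ) (ω : W) : EuclideanSpace ℝ (Fin p) :=
  Q.delta η (R.B (s + 1) ω) (R.idx s t ω) (R.xin s 0 ω) (R.xhat s t ω)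

/-! ### Supports -/

theorem supportedOn_xin (hη : 0 < η) {s : ℕ} (hs : s < S) {t : ℕ} (ht : t ≤ K) (ω : W) :
    Q.SupportedOn (R.B (s + 1) ω) (R.xin s t ω) := by
  induction t with
  | zero => rw [R.xin_zero s hs]; exact Q.supportedOn_restr _ _
  | succ t ih =>
    rw [R.xin_succ s hs t ht]
    exact (ih (Nat.le_of_succ_le ht)).add (supportedOn_delta hη _ _ _ _)

theorem supportedOn_xhat (hη : 0 < η) {s : ℕ} (hs : s < S) {t : ℕ} (ht : t < K) (ω : W) :
    Q.SupportedOn (R.B (s + 1) ω) (R.xhat s t ω) := by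
  intro k hk
  obtain ⟨M, _, h⟩ := R.read s hs t ht ω k
  rw [h, R.supportedOn_xin hη hs ht.le ω k hk, zero_sub, neg_eq_zero]
  exact Finset.sum_eq_zero fun u _ => supportedOn_delta hη _ _ _ _ k hk

theorem screening_safe (hη : 0 < η) (hn : 0 < n) (hℓ : 0 < ℓ)
    (hdiff : ∀ i, Differentiable ℝ (Q.f i))
    (hscalar : ∀ i, ∀ z z' : ℝ, |deriv (Q.f i) z - deriv (Q.f i) z'| ≤ ℓ * |z - z'|)
    (hc : 0 < c) (hc' : c ≤ n * Q.lam) {z : EuclideanSpace ℝ (Fin p)}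
    (hz : Q.IsSolution Finset.univ z) {s : ℕ} (hs : s ≤ S) (ω : W) :
    Q.SupportedOn (R.B s ω) (R.x s ω) ∧ Q.IsSolution (R.B s ω) z := by
  induction s with
  | zero =>
    rw [R.B_zero]
    exact ⟨fun k hk => absurd (Finset.mem_univ _) hk, hz⟩
  | succ s ih =>
    obtain ⟨h1, h2⟩ := ih (Nat.le_of_succ_le hs)
    refine ⟨?_, ?_⟩
    · rw [R.x_succ s hs]
      exact R.supportedOn_xin hη hs le_rfl ω
    · rw [R.B_succ s hs]
      exact h2.screen hn hℓ hdiff hscalar hc hc' h1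

/-! ### All random variables take finitely many values -/

theorem lex_le_succ (s t : ℕ) : toLex (s, t) ≤ toLex (s, t + 1) :=
  Prod.Lex.toLex_le_toLex.2 (Or.inr ⟨rfl, Nat.le_succ t⟩)

theorem lex_lt_succ (s t : ℕ) : toLex (s, t) < toLex (s, t + 1) :=
  Prod.Lex.toLex_lt_toLex.2 (Or.inr ⟨rfl, Nat.lt_succ_self t⟩)

/-- The missed sets may depend on the outcome non-measurably, so only finiteness is shown here, in
the σ-algebra `⊤`; measurability of the read comes from the history. -/
theorem finite_range_xhat {s : ℕ} (hs : s < S) {t : ℕ} (ht : t < K)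
    (hxin : (Set.range (R.xin s t)).Finite)
    (hupd : ∀ u < t, (Set.range (R.upd s u)).Finite) : (Set.range (R.xhat s t)).Finite := by
  choose M hM hread using fun ω k => R.read s hs t ht ω k
  have hcoord : ∀ k, FinitelyMeasurable (⊤ : MeasurableSpace W) (fun ω => R.xhat s t ω k) := by
    intro k
    have e : (fun ω => R.xhat s t ω k) = fun ω => R.xin s t ω k
        - ∑ u ∈ Finset.Ico (t - τ) t, (if u ∈ M ω k then R.upd s u ω k else 0) := by
      ext ω
      rw [hread, ← Finset.sum_filter, Finset.filter_mem_eq_inter,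
        Finset.inter_eq_right.2 (hM ω k)]
      rfl
    rw [e]
    refine ((FinitelyMeasurable.of_finite_range hxin).comp fun x => x k).comp₂
      (FinitelyMeasurable.finset_sum _ fun u hu => ?_) (fun a b : ℝ => a - b)
    have h1 := FinitelyMeasurable.of_finite_range (hupd u (Finset.mem_Ico.1 hu).2)
    have h2 : FinitelyMeasurable (⊤ : MeasurableSpace W) (fun ω => decide (u ∈ M ω k)) :=
      FinitelyMeasurable.of_finite_range (Set.toFinite _)
    simpa using h2.comp₂ h1 (fun (b : Bool) x => if b then x k else 0)
  have hpi : (Set.pi Set.univ fun k => Set.range fun ω => R.xhat s t ω k).Finite :=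
    Set.Finite.pi' (fun k => (hcoord k).1) |>.subset fun f hf k => hf k (Set.mem_univ k)
  refine Set.Finite.of_finite_image (f := fun x : EuclideanSpace ℝ (Fin p) => (x : Fin p → ℝ))
    (hpi.subset ?_) (fun x _ y _ h => by ext k; exact congrFun h k)
  rintro _ ⟨_, ⟨ω, rfl⟩, rfl⟩ k _
  exact ⟨ω, rfl⟩

theorem finitelyMeasurable_idx {s : ℕ} (hs : s < S) {t : ℕ} (ht : t < K) {a : ℕ ×ₗ ℕ}
    (ha : toLex (s, t) < a) : FinitelyMeasurable (R.hist a) (R.idx s t) :=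
  ⟨Set.toFinite _, fun i => R.idx_measurable s hs t ht a ha (measurableSet_singleton i)⟩

theorem finitelyMeasurable_xhat {s : ℕ} (hs : s < S) {t : ℕ} (ht : t < K)
    (hfin : (Set.range (R.xhat s t)).Finite) :
    FinitelyMeasurable (R.hist (toLex (s, t))) (R.xhat s t) :=
  ⟨hfin, fun y => R.read_measurable s hs t ht (measurableSet_singleton y)⟩

/-- All updates before t must be known to the history at t, as the independence of sample t is
applied to functions of them. -/
theorem finitelyMeasurable_inner {s : ℕ} (hs : s < S)
    (hx : FinitelyMeasurable (R.hist (toLex (s, 0))) (R.x s))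
    (hB : FinitelyMeasurable (R.hist (toLex (s, 0))) (R.B (s + 1))) {t : ℕ} (ht : t ≤ K) :
    FinitelyMeasurable (R.hist (toLex (s, t))) (R.B (s + 1)) ∧
    FinitelyMeasurable (R.hist (toLex (s, t))) (R.xin s 0) ∧
    FinitelyMeasurable (R.hist (toLex (s, t))) (R.xin s t) ∧
    (∀ u < t, FinitelyMeasurable (R.hist (toLex (s, t))) (R.upd s u)) ∧
    (t < K → FinitelyMeasurable (R.hist (toLex (s, t))) (R.xhat s t)) := by
  induction t with
  | zero =>
    have h0 : FinitelyMeasurable (R.hist (toLex (s, 0))) (R.xin s 0) := by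
      have e : R.xin s 0 = fun ω => Q.restr (R.B (s + 1) ω) (R.x s ω) :=
        funext (R.xin_zero s hs)
      rw [e]
      exact hB.comp₂ hx Q.restr
    exact ⟨hB, h0, h0, fun u hu => absurd hu (Nat.not_lt_zero u), fun hK =>
      R.finitelyMeasurable_xhat hs hK
        (R.finite_range_xhat hs hK h0.1 fun u hu => absurd hu (Nat.not_lt_zero u))⟩
  | succ t ih =>
    obtain ⟨h1, h2, h3, h4, h5⟩ := ih (Nat.le_of_succ_le ht)
    have hle := R.hist.mono (lex_le_succ s t)
    have hupd : FinitelyMeasurable (R.hist (toLex (s, t + 1))) (R.upd s t) :=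
      (((h1.mono hle).prodMk (R.finitelyMeasurable_idx hs ht (lex_lt_succ s t))).prodMk
        ((h2.mono hle).prodMk ((h5 ht).mono hle))).comp
        fun y => Q.delta η y.1.1 y.1.2 y.2.1 y.2.2
    have hxin : FinitelyMeasurable (R.hist (toLex (s, t + 1))) (R.xin s (t + 1)) := by
      have e : R.xin s (t + 1) = fun ω => R.xin s t ω + R.upd s t ω :=
        funext (R.xin_succ s hs t ht)
      rw [e]
      exact (h3.mono hle).comp₂ hupd (· + ·)
    have hall : ∀ u < t + 1, FinitelyMeasurable (R.hist (toLex (s, t + 1))) (R.upd s u) := by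
      intro u hu
      rcases Nat.lt_succ_iff_lt_or_eq.1 hu with h | rfl
      · exact (h4 u h).mono hle
      · exact hupd
    exact ⟨h1.mono hle, h2.mono hle, hxin, hall, fun hK => R.finitelyMeasurable_xhat hs hK
      (R.finite_range_xhat hs hK hxin.1 fun u hu => (hall u hu).1)⟩

theorem finitelyMeasurable_outer {s : ℕ} (hs : s ≤ S) :
    FinitelyMeasurable (R.hist (toLex (s, 0))) (R.x s) ∧
    FinitelyMeasurable (R.hist (toLex (s, 0))) (R.B s) := by
  induction s with
  | zero =>
    rw [show R.x 0 = fun _ => x₀ from funext R.x_zero,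
      show R.B 0 = fun _ => Finset.univ from funext R.B_zero]
    exact ⟨.const _, .const _⟩
  | succ s ih =>
    obtain ⟨h1, h2⟩ := ih (Nat.le_of_succ_le hs)
    have hB : FinitelyMeasurable (R.hist (toLex (s, 0))) (R.B (s + 1)) := by
      rw [show R.B (s + 1) = fun ω => Q.screen σ c ℓ (R.B s ω) (R.x s ω) from
        funext (R.B_succ s hs)]
      exact h2.comp₂ h1 _
    obtain ⟨h3, -, h4, -, -⟩ := R.finitelyMeasurable_inner hs h1 hB le_rfl
    have hle : R.hist (toLex (s, K)) ≤ R.hist (toLex (s + 1, 0)) :=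
      R.hist.mono (Prod.Lex.toLex_le_toLex.2 (Or.inl (Nat.lt_succ_self s)))
    rw [show R.x (s + 1) = R.xin s K from funext (R.x_succ s hs)]
    exact ⟨h4.mono hle, h3.mono hle⟩

theorem finitelyMeasurable_loop {s : ℕ} (hs : s < S) {t : ℕ} (ht : t ≤ K) :
    FinitelyMeasurable (R.hist (toLex (s, t))) (R.B (s + 1)) ∧
    FinitelyMeasurable (R.hist (toLex (s, t))) (R.xin s 0) ∧
    FinitelyMeasurable (R.hist (toLex (s, t))) (R.xin s t) ∧
    (∀ u < t, FinitelyMeasurable (R.hist (toLex (s, t))) (R.upd s u)) ∧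
    (t < K → FinitelyMeasurable (R.hist (toLex (s, t))) (R.xhat s t)) := by
  obtain ⟨h1, h2⟩ := R.finitelyMeasurable_outer hs.le
  refine R.finitelyMeasurable_inner hs h1 ?_ ht
  rw [show R.B (s + 1) = fun ω => Q.screen σ c ℓ (R.B s ω) (R.x s ω) from funext (R.B_succ s hs)]
  exact h2.comp₂ h1 _

theorem finitelyMeasurable_x {s : ℕ} (hs : s ≤ S) : FinitelyMeasurable mW (R.x s) :=
  (R.finitelyMeasurable_outer hs).1.mono (R.hist.le _)

theorem finitelyMeasurable_xin {s : ℕ} (hs : s < S) {t : ℕ} (ht : t ≤ K) :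
    FinitelyMeasurable mW (R.xin s t) :=
  (R.finitelyMeasurable_loop hs ht).2.2.1.mono (R.hist.le _)

theorem finitelyMeasurable_xhat' {s : ℕ} (hs : s < S) {t : ℕ} (ht : t < K) :
    FinitelyMeasurable mW (R.xhat s t) :=
  ((R.finitelyMeasurable_loop hs ht.le).2.2.2.2 ht).mono (R.hist.le _)

theorem finitelyMeasurable_upd {s : ℕ} (hs : s < S) {t : ℕ} (ht : t < K) :
    FinitelyMeasurable mW (R.upd s t) :=
  ((R.finitelyMeasurable_loop hs (t := t + 1) ht).2.2.2.1 t (Nat.lt_succ_self t)).mono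
    (R.hist.le _)

theorem finitelyMeasurable_B {s : ℕ} (hs : s < S) : FinitelyMeasurable mW (R.B (s + 1)) :=
  (R.finitelyMeasurable_loop hs (Nat.zero_le K)).1.mono (R.hist.le _)

theorem finitelyMeasurable_idx' {s : ℕ} (hs : s < S) {t : ℕ} (ht : t < K) :
    FinitelyMeasurable mW (R.idx s t) :=
  (R.finitelyMeasurable_idx hs ht (lex_lt_succ s t)).mono (R.hist.le _)

theorem integral_sample [IsProbabilityMeasure Pr] {s : ℕ} (hs : s < S) {t : ℕ} (ht : t < K)
    {G : W → Fin n → ℝ}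
    (hG : ∀ i, FinitelyMeasurable (R.hist (toLex (s, t))) (fun ω => G ω i)) :
    ∫ ω, G ω (R.idx s t ω) ∂Pr = (1 / (n : ℝ)) * ∫ ω, ∑ i, G ω i ∂Pr :=
  integral_uniform_sample (R.hist.le _) (R.finitelyMeasurable_idx' hs ht).measurable
    (R.idx_uniform s hs t ht) (R.idx_indep s hs t ht) hG

end ShaDDSS

end CompositeProblem

namespace CompositeProblem

theorem integral_sub_sub_add_add {W : Type*} [MeasurableSpace W] {Pr : Measure W}
    {f₁ f₂ f₃ f₄ f₅ : W → ℝ} (h₁ : Integrable f₁ Pr) (h₂ : Integrable f₂ Pr)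
    (h₃ : Integrable f₃ Pr) (h₄ : Integrable f₄ Pr) (h₅ : Integrable f₅ Pr) :
    ∫ ω, (f₁ ω - f₂ ω - f₃ ω + f₄ ω + f₅ ω) ∂Pr
      = ∫ ω, f₁ ω ∂Pr - ∫ ω, f₂ ω ∂Pr - ∫ ω, f₃ ω ∂Pr + ∫ ω, f₄ ω ∂Pr + ∫ ω, f₅ ω ∂Pr := by
  rw [← integral_sub' h₁ h₂, ← integral_sub' (h₁.sub h₂) h₃,
    ← integral_add' ((h₁.sub h₂).sub h₃) h₄, ← integral_add' (((h₁.sub h₂).sub h₃).add h₄) h₅]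
  rfl

/-! ### Overlapping updates -/

theorem abs_inner_le_absInner {p : ℕ} (x y : EuclideanSpace ℝ (Fin p)) :
    |inner ℝ x y| ≤ absInner x y := by
  rw [inner_eq_sum]
  refine (Finset.abs_sum_le_sum_abs _ _).trans (le_of_eq ?_)
  exact Finset.sum_congr rfl fun k _ => abs_mul _ _

theorem inner_le_sum_absInner {p : ℕ} {ι : Type*} (s : Finset ι) (x y : EuclideanSpace ℝ (Fin p))
    (v : ι → EuclideanSpace ℝ (Fin p)) (h : ∀ k, |y k| ≤ ∑ u ∈ s, |v u k|) :
    inner ℝ x y ≤ ∑ u ∈ s, absInner (v u) x := by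
  refine (le_abs_self _).trans ((abs_inner_le_absInner x y).trans ?_)
  simp only [absInner]
  rw [Finset.sum_comm]
  refine Finset.sum_le_sum fun k _ => ?_
  rw [← Finset.sum_mul, mul_comm]
  exact mul_le_mul_of_nonneg_right (h k) (abs_nonneg _)

/-- The missed updates differ from coordinate to coordinate, so signed inner products are useless;
domination by coordinatewise absolute values covers every choice of missed sets. -/
theorem norm_sq_le_sum_absInner {p : ℕ} {ι : Type*} (s : Finset ι) (y : EuclideanSpace ℝ (Fin p))
    (v : ι → EuclideanSpace ℝ (Fin p)) (h : ∀ k, |y k| ≤ ∑ u ∈ s, |v u k|) :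
    ‖y‖ ^ 2 ≤ ∑ u ∈ s, ∑ w ∈ s, absInner (v u) (v w) := by
  have e : ∑ u ∈ s, ∑ w ∈ s, absInner (v u) (v w) = ∑ k, (∑ u ∈ s, |v u k|) ^ 2 := by
    simp only [absInner, sq, Finset.sum_mul_sum]
    symm
    rw [Finset.sum_comm]
    exact Finset.sum_congr rfl fun u _ => Finset.sum_comm
  rw [e, norm_sq_eq_sum]
  refine Finset.sum_le_sum fun k _ => ?_
  rw [← sq_abs]
  exact pow_le_pow_left₀ (abs_nonneg _) (h k) 2

namespace ShaDDSS

variable {n p q : ℕ} {Q : CompositeProblem n p q} {σ c ℓ η : ℝ} {τ K S : ℕ}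
  {x₀ : EuclideanSpace ℝ (Fin p)} {W : Type*} [mW : MeasurableSpace W] {Pr : Measure W}
  (R : Q.ShaDDSS σ c ℓ η τ K S x₀ Pr)

theorem abs_xin_sub_xhat_le {s : ℕ} (hs : s < S) {t : ℕ} (ht : t < K) (ω : W) (k : Fin p) :
    |(R.xin s t ω - R.xhat s t ω) k| ≤ ∑ u ∈ Finset.Ico (t - τ) t, |R.upd s u ω k| := by
  obtain ⟨M, hM, h⟩ := R.read s hs t ht ω k
  rw [PiLp.sub_apply, h, sub_sub_cancel]
  exact (Finset.abs_sum_le_sum_abs _ _).trans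
    (Finset.sum_le_sum_of_subset_of_nonneg hM fun _ _ _ => abs_nonneg _)

variable [IsProbabilityMeasure Pr]

/-- The expected overlap of two updates of the same loop is small if the samples are sparse. -/
theorem integral_absInner_upd_le_of_lt (hη : 0 < η) (hn : 0 < n) (hΔ : 0 < Q.Delta) {s : ℕ}
    (hs : s < S) {u t : ℕ} (hut : u < t) (ht : t < K) :
    ∫ ω, absInner (R.upd s u ω) (R.upd s t ω) ∂Pr
      ≤ √Q.Delta / 2 * (∫ ω, ‖R.upd s u ω‖ ^ 2 ∂Pr + ∫ ω, ‖R.upd s t ω‖ ^ 2 ∂Pr) := by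
  have hn' : (0 : ℝ) < n := Nat.cast_pos.2 hn
  have hε : 0 < √Q.Delta := Real.sqrt_pos.2 hΔ
  have hu := R.finitelyMeasurable_upd hs (hut.trans ht)
  have ht' := R.finitelyMeasurable_upd hs ht
  have hh := (R.finitelyMeasurable_loop hs ht.le).2.2.2.1 u hut
  have hidx := R.finitelyMeasurable_idx' hs ht
  -- Young with ε = √Δ: averaging over sample t turns the first term 1/(2√Δ) into Δ/(2√Δ) = √Δ/2,
  -- which balances the second.
  have h1 : ∫ ω, absInner (R.upd s u ω) (R.upd s t ω) ∂Pr
      ≤ ∫ ω, (1 / (2 * √Q.Delta) * ‖Q.restr (Q.Psi (R.idx s t ω)) (R.upd s u ω)‖ ^ 2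
        + √Q.Delta / 2 * ‖R.upd s t ω‖ ^ 2) ∂Pr := by
    refine integral_mono ((hu.comp₂ ht' absInner).integrable le_rfl)
      (((hidx.prodMk hu).comp₂ ht' fun a b => 1 / (2 * √Q.Delta) * ‖Q.restr (Q.Psi a.1) a.2‖ ^ 2
        + √Q.Delta / 2 * ‖b‖ ^ 2).integrable le_rfl) fun ω => ?_
    exact absInner_delta_le hη hε _ _ _ _ _
  rw [integral_add (((hidx.comp₂ hu fun a b =>
      1 / (2 * √Q.Delta) * ‖Q.restr (Q.Psi a) b‖ ^ 2)).integrable le_rfl)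
    ((ht'.comp fun b => √Q.Delta / 2 * ‖b‖ ^ 2).integrable le_rfl), integral_const_mul,
    integral_const_mul, R.integral_sample hs ht
      (G := fun ω i => ‖Q.restr (Q.Psi i) (R.upd s u ω)‖ ^ 2)
      (fun i => hh.comp fun b => ‖Q.restr (Q.Psi i) b‖ ^ 2)] at h1
  have h2 : ∫ ω, ∑ i, ‖Q.restr (Q.Psi i) (R.upd s u ω)‖ ^ 2 ∂Pr
      ≤ n * (Q.Delta * ∫ ω, ‖R.upd s u ω‖ ^ 2 ∂Pr) := by
    rw [← integral_const_mul, ← integral_const_mul]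
    exact integral_mono ((hu.comp fun b => ∑ i, ‖Q.restr (Q.Psi i) b‖ ^ 2).integrable le_rfl)
      ((hu.comp fun b => n * (Q.Delta * ‖b‖ ^ 2)).integrable le_rfl)
      fun ω => sum_norm_restr_Psi_sq_le hn _
  have h3 : 1 / (2 * √Q.Delta) * (1 / (n : ℝ)
      * ∫ ω, ∑ i, ‖Q.restr (Q.Psi i) (R.upd s u ω)‖ ^ 2 ∂Pr)
      ≤ 1 / (2 * √Q.Delta) * (1 / (n : ℝ) * (n * (Q.Delta * ∫ ω, ‖R.upd s u ω‖ ^ 2 ∂Pr))) := by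
    gcongr
  have h4 : 1 / (2 * √Q.Delta) * (1 / (n : ℝ) * (n * (Q.Delta * ∫ ω, ‖R.upd s u ω‖ ^ 2 ∂Pr)))
      = √Q.Delta / 2 * ∫ ω, ‖R.upd s u ω‖ ^ 2 ∂Pr := by
    have e : Q.Delta = √Q.Delta * √Q.Delta := (Real.mul_self_sqrt hΔ.le).symm
    generalize √Q.Delta = r at *
    rw [e]
    field_simp
  linarith

theorem integral_absInner_upd_le (hη : 0 < η) (hn : 0 < n) (hΔ : 0 < Q.Delta) {s : ℕ}
    (hs : s < S) {u t : ℕ} (hu : u < K) (ht : t < K) :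
    ∫ ω, absInner (R.upd s u ω) (R.upd s t ω) ∂Pr
      ≤ (if u = t then ∫ ω, ‖R.upd s u ω‖ ^ 2 ∂Pr else 0)
        + √Q.Delta / 2 * (∫ ω, ‖R.upd s u ω‖ ^ 2 ∂Pr + ∫ ω, ‖R.upd s t ω‖ ^ 2 ∂Pr) := by
  rcases lt_trichotomy u t with h | rfl | h
  · rw [if_neg h.ne, zero_add]
    exact R.integral_absInner_upd_le_of_lt hη hn hΔ hs h ht
  · simp only [absInner_self, if_true]
    have : 0 ≤ ∫ ω, ‖R.upd s u ω‖ ^ 2 ∂Pr := integral_nonneg fun ω => sq_nonneg _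
    have h2 : 0 ≤ √Q.Delta / 2 * (∫ ω, ‖R.upd s u ω‖ ^ 2 ∂Pr + ∫ ω, ‖R.upd s u ω‖ ^ 2 ∂Pr) := by
      positivity
    linarith
  · rw [if_neg h.ne', zero_add]
    simp only [absInner_comm (R.upd s u _)]
    rw [add_comm (∫ ω, ‖R.upd s u ω‖ ^ 2 ∂Pr)]
    exact R.integral_absInner_upd_le_of_lt hη hn hΔ hs h hu

theorem card_window_le {τ t : ℕ} : ((Finset.Ico (t - τ) t).card : ℝ) ≤ τ := by
  rw [Nat.card_Ico]
  exact_mod_cast (by omega : t - (t - τ) ≤ τ)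

/-- The interaction of an update with the updates that its read misses. -/
theorem two_integral_inner_upd_le (hη : 0 < η) (hn : 0 < n) (hΔ : 0 < Q.Delta) {s : ℕ}
    (hs : s < S) {t : ℕ} (ht : t < K) :
    2 * ∫ ω, inner ℝ (R.upd s t ω) (R.xin s t ω - R.xhat s t ω) ∂Pr
      ≤ √Q.Delta * τ * ∫ ω, ‖R.upd s t ω‖ ^ 2 ∂Pr
        + √Q.Delta * ∑ u ∈ Finset.Ico (t - τ) t, ∫ ω, ‖R.upd s u ω‖ ^ 2 ∂Pr := by
  have ht' := R.finitelyMeasurable_upd hs ht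
  have hK : ∀ u ∈ Finset.Ico (t - τ) t, u < K := fun u hu => (Finset.mem_Ico.1 hu).2.trans ht
  have hI : ∀ u ∈ Finset.Ico (t - τ) t,
      FinitelyMeasurable mW (fun ω => absInner (R.upd s u ω) (R.upd s t ω)) := fun u hu =>
    (R.finitelyMeasurable_upd hs (hK u hu)).comp₂ ht' absInner
  have h1 : ∫ ω, inner ℝ (R.upd s t ω) (R.xin s t ω - R.xhat s t ω) ∂Pr
      ≤ ∑ u ∈ Finset.Ico (t - τ) t, ∫ ω, absInner (R.upd s u ω) (R.upd s t ω) ∂Pr := by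
    rw [← integral_finsetSum _ fun u hu => (hI u hu).integrable le_rfl]
    refine integral_mono ((ht'.comp₂ ((R.finitelyMeasurable_xin hs ht.le).comp₂
      (R.finitelyMeasurable_xhat' hs ht) (· - ·)) (inner ℝ)).integrable le_rfl)
      ((FinitelyMeasurable.finset_sum _ hI).integrable le_rfl) fun ω => ?_
    exact inner_le_sum_absInner _ _ _ _ (R.abs_xin_sub_xhat_le hs ht ω)
  have h2 : ∑ u ∈ Finset.Ico (t - τ) t, ∫ ω, absInner (R.upd s u ω) (R.upd s t ω) ∂Pr
      ≤ ∑ u ∈ Finset.Ico (t - τ) t, √Q.Delta / 2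
        * (∫ ω, ‖R.upd s u ω‖ ^ 2 ∂Pr + ∫ ω, ‖R.upd s t ω‖ ^ 2 ∂Pr) :=
    Finset.sum_le_sum fun u hu =>
      R.integral_absInner_upd_le_of_lt hη hn hΔ hs (Finset.mem_Ico.1 hu).2 ht
  rw [← Finset.mul_sum, Finset.sum_add_distrib, Finset.sum_const, nsmul_eq_mul] at h2
  have hD : 0 ≤ ∫ ω, ‖R.upd s t ω‖ ^ 2 ∂Pr := integral_nonneg fun ω => sq_nonneg _
  have h3 := mul_le_mul_of_nonneg_right (card_window_le (τ := τ) (t := t)) hD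
  have h4 := mul_le_mul_of_nonneg_left h3 (Real.sqrt_nonneg Q.Delta)
  linarith

/-- The expected inconsistency of a read. -/
theorem integral_norm_xin_sub_xhat_sq_le (hη : 0 < η) (hn : 0 < n) (hΔ : 0 < Q.Delta) {s : ℕ}
    (hs : s < S) {t : ℕ} (ht : t < K) :
    ∫ ω, ‖R.xin s t ω - R.xhat s t ω‖ ^ 2 ∂Pr
      ≤ (1 + √Q.Delta * τ) * ∑ u ∈ Finset.Ico (t - τ) t, ∫ ω, ‖R.upd s u ω‖ ^ 2 ∂Pr := by
  have hK : ∀ u ∈ Finset.Ico (t - τ) t, u < K := fun u hu => (Finset.mem_Ico.1 hu).2.trans ht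
  have hI : ∀ u ∈ Finset.Ico (t - τ) t, ∀ v ∈ Finset.Ico (t - τ) t,
      FinitelyMeasurable mW (fun ω => absInner (R.upd s u ω) (R.upd s v ω)) := fun u hu v hv =>
    (R.finitelyMeasurable_upd hs (hK u hu)).comp₂ (R.finitelyMeasurable_upd hs (hK v hv)) absInner
  set D : ℕ → ℝ := fun u => ∫ ω, ‖R.upd s u ω‖ ^ 2 ∂Pr with hDdef
  have hD : ∀ u, 0 ≤ D u := fun u => integral_nonneg fun ω => sq_nonneg _
  have h1 : ∫ ω, ‖R.xin s t ω - R.xhat s t ω‖ ^ 2 ∂Pr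
      ≤ ∑ u ∈ Finset.Ico (t - τ) t, ∑ v ∈ Finset.Ico (t - τ) t,
        ∫ ω, absInner (R.upd s u ω) (R.upd s v ω) ∂Pr := by
    have e : ∑ u ∈ Finset.Ico (t - τ) t, ∑ v ∈ Finset.Ico (t - τ) t,
        ∫ ω, absInner (R.upd s u ω) (R.upd s v ω) ∂Pr
        = ∫ ω, ∑ u ∈ Finset.Ico (t - τ) t, ∑ v ∈ Finset.Ico (t - τ) t,
          absInner (R.upd s u ω) (R.upd s v ω) ∂Pr := by
      rw [integral_finsetSum _ fun u hu =>
        (FinitelyMeasurable.finset_sum _ (hI u hu)).integrable le_rfl]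
      exact Finset.sum_congr rfl fun u hu =>
        (integral_finsetSum _ fun v hv => (hI u hu v hv).integrable le_rfl).symm
    rw [e]
    refine integral_mono ((((R.finitelyMeasurable_xin hs ht.le).comp₂
      (R.finitelyMeasurable_xhat' hs ht) fun a b => ‖a - b‖ ^ 2)).integrable le_rfl)
      ((FinitelyMeasurable.finset_sum _ fun u hu =>
        FinitelyMeasurable.finset_sum _ (hI u hu)).integrable le_rfl) fun ω => ?_
    exact norm_sq_le_sum_absInner _ _ _ (R.abs_xin_sub_xhat_le hs ht ω)
  have h2 : ∑ u ∈ Finset.Ico (t - τ) t, ∑ v ∈ Finset.Ico (t - τ) t,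
        ∫ ω, absInner (R.upd s u ω) (R.upd s v ω) ∂Pr
      ≤ ∑ u ∈ Finset.Ico (t - τ) t, ∑ v ∈ Finset.Ico (t - τ) t,
        ((if u = v then D u else 0) + √Q.Delta / 2 * (D u + D v)) :=
    Finset.sum_le_sum fun u hu => Finset.sum_le_sum fun v hv =>
      R.integral_absInner_upd_le hη hn hΔ hs (hK u hu) (hK v hv)
  have e2 : ∑ u ∈ Finset.Ico (t - τ) t, ∑ v ∈ Finset.Ico (t - τ) t,
        ((if u = v then D u else 0) + √Q.Delta / 2 * (D u + D v))
      = ∑ u ∈ Finset.Ico (t - τ) t, D u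
        + √Q.Delta * (((Finset.Ico (t - τ) t).card : ℝ) * ∑ u ∈ Finset.Ico (t - τ) t, D u) := by
    simp only [Finset.sum_add_distrib, ← Finset.mul_sum, Finset.sum_const, nsmul_eq_mul]
    rw [Finset.sum_congr rfl fun u hu => by rw [Finset.sum_ite_eq, if_pos hu]]
    ring
  have hS : 0 ≤ ∑ u ∈ Finset.Ico (t - τ) t, D u := Finset.sum_nonneg fun u _ => hD u
  have h3 := mul_le_mul_of_nonneg_left (mul_le_mul_of_nonneg_right
    (card_window_le (τ := τ) (t := t)) hS) (Real.sqrt_nonneg Q.Delta)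
  linarith

/-! ### Contraction -/

/-- The pointwise step estimate, averaged over sample t. The read, the reference point and the
active set are fixed by the history, so the V terms become sums over all samples. -/
theorem integral_step_le {μ L : ℝ} (hη : 0 < η) (hn : 0 < n)
    (hdiff : ∀ i, Differentiable ℝ (Q.f i))
    (hconv : ∀ x x' : EuclideanSpace ℝ (Fin p),
      Q.F x + inner ℝ (gradient Q.F x) (x' - x) + μ / 2 * ‖x' - x‖ ^ 2 ≤ Q.F x')
    (hsmooth : ∀ i, ∀ x x' : EuclideanSpace ℝ (Fin p),
      ‖gradient (Q.Fi i) x - gradient (Q.Fi i) x'‖ ≤ L * ‖x - x'‖)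
    (hocc : ∀ k, Q.occ (Q.blk k) ≠ 0) {s : ℕ} (hs : s < S) {z : EuclideanSpace ℝ (Fin p)}
    (hz : ∀ ω, Q.IsSolution (R.B (s + 1) ω) z) {t : ℕ} (ht : t < K) :
    ∫ ω, ‖R.xin s (t + 1) ω - z‖ ^ 2 ∂Pr ≤ ∫ ω, ‖R.xin s t ω - z‖ ^ 2 ∂Pr
      - 1 / 2 * ∫ ω, ‖R.upd s t ω‖ ^ 2 ∂Pr
      - 2 * η * (μ * ∫ ω, ‖R.xhat s t ω - z‖ ^ 2 ∂Pr)
      + 2 * η ^ 2 * (2 * L ^ 2 * (∫ ω, ‖R.xhat s t ω - z‖ ^ 2 ∂Pr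
        + ∫ ω, ‖R.xin s 0 ω - z‖ ^ 2 ∂Pr))
      + 2 * ∫ ω, inner ℝ (R.upd s t ω) (R.xin s t ω - R.xhat s t ω) ∂Pr := by
  have hn' : (0 : ℝ) < n := Nat.cast_pos.2 hn
  have fx := R.finitelyMeasurable_xin hs ht.le
  have fx1 := R.finitelyMeasurable_xin hs (t := t + 1) ht
  have f0 := R.finitelyMeasurable_xin hs (Nat.zero_le K)
  have fh := R.finitelyMeasurable_xhat' hs ht
  have fu := R.finitelyMeasurable_upd hs ht
  have fi := R.finitelyMeasurable_idx' hs ht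
  have fB := R.finitelyMeasurable_B hs
  obtain ⟨mB, m0, -, -, mh⟩ := R.finitelyMeasurable_loop hs ht.le
  replace mh := mh ht
  set V : W → Fin n → EuclideanSpace ℝ (Fin p) := fun ω i =>
    Q.centeredGrad (R.B (s + 1) ω) i (R.xin s 0 ω) z (R.xhat s t ω) with hV
  have mV : ∀ i, FinitelyMeasurable (R.hist (toLex (s, t))) (fun ω => V ω i) := fun i =>
    (mB.prodMk m0).comp₂ mh fun a b => Q.centeredGrad a.1 i a.2 z b
  have fV : FinitelyMeasurable mW (fun ω => V ω (R.idx s t ω)) :=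
    ((fB.prodMk f0).prodMk fi).comp₂ fh fun a b => Q.centeredGrad a.1.1 a.2 a.1.2 z b
  have fsum : ∀ g : EuclideanSpace ℝ (Fin p) → EuclideanSpace ℝ (Fin p) → ℝ,
      Integrable (fun ω => ∑ i, g (V ω i) (R.xhat s t ω)) Pr := fun g =>
    (FinitelyMeasurable.finset_sum _ fun i _ => (mV i).comp₂ mh g).integrable (R.hist.le _)
  have I1 : Integrable (fun ω => ‖R.xin s t ω - z‖ ^ 2) Pr :=
    (fx.comp fun a => ‖a - z‖ ^ 2).integrable le_rfl
  have I2 : Integrable (fun ω => 1 / 2 * ‖R.upd s t ω‖ ^ 2) Pr :=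
    (fu.comp fun a => 1 / 2 * ‖a‖ ^ 2).integrable le_rfl
  have I3 : Integrable (fun ω => 2 * η * inner ℝ (V ω (R.idx s t ω)) (R.xhat s t ω - z)) Pr :=
    (fV.comp₂ fh fun a b => 2 * η * inner ℝ a (b - z)).integrable le_rfl
  have I4 : Integrable (fun ω => 2 * η ^ 2 * ‖V ω (R.idx s t ω)‖ ^ 2) Pr :=
    (fV.comp fun a => 2 * η ^ 2 * ‖a‖ ^ 2).integrable le_rfl
  have I5 : Integrable
      (fun ω => 2 * inner ℝ (R.upd s t ω) (R.xin s t ω - R.xhat s t ω)) Pr :=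
    (fu.comp₂ (fx.comp₂ fh (· - ·)) fun a b => 2 * inner ℝ a b).integrable le_rfl
  have hpt : ∫ ω, ‖R.xin s (t + 1) ω - z‖ ^ 2 ∂Pr ≤ ∫ ω, (‖R.xin s t ω - z‖ ^ 2
      - 1 / 2 * ‖R.upd s t ω‖ ^ 2
      - 2 * η * inner ℝ (V ω (R.idx s t ω)) (R.xhat s t ω - z)
      + 2 * η ^ 2 * ‖V ω (R.idx s t ω)‖ ^ 2
      + 2 * inner ℝ (R.upd s t ω) (R.xin s t ω - R.xhat s t ω)) ∂Pr := by
    refine integral_mono ((fx1.comp fun a => ‖a - z‖ ^ 2).integrable le_rfl)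
      ((((I1.sub I2).sub I3).add I4).add I5) fun ω => ?_
    simp only
    rw [R.xin_succ s hs t ht]
    exact (hz ω).norm_step_le hdiff hη _ _ _ _
  rw [integral_sub_sub_add_add I1 I2 I3 I4 I5, integral_const_mul, integral_const_mul,
    integral_const_mul, integral_const_mul,
    R.integral_sample hs ht (G := fun ω i => inner ℝ (V ω i) (R.xhat s t ω - z))
      (fun i => (mV i).comp₂ mh fun a b => inner ℝ a (b - z)),
    R.integral_sample hs ht (G := fun ω i => ‖V ω i‖ ^ 2)
      (fun i => (mV i).comp fun a => ‖a‖ ^ 2)] at hpt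
  have Ih : Integrable (fun ω => ‖R.xhat s t ω - z‖ ^ 2) Pr :=
    (fh.comp fun a => ‖a - z‖ ^ 2).integrable le_rfl
  have I0 : Integrable (fun ω => ‖R.xin s 0 ω - z‖ ^ 2) Pr :=
    (f0.comp fun a => ‖a - z‖ ^ 2).integrable le_rfl
  have hb : n * (μ * ∫ ω, ‖R.xhat s t ω - z‖ ^ 2 ∂Pr)
      ≤ ∫ ω, ∑ i, inner ℝ (V ω i) (R.xhat s t ω - z) ∂Pr := by
    rw [← integral_const_mul, ← integral_const_mul]
    refine integral_mono ((Ih.const_mul μ).const_mul _) (fsum fun a b => inner ℝ a (b - z))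
      fun ω => ?_
    simp only [hV]
    rw [sum_inner_centeredGrad hn hdiff hocc _ _ _
      ((R.supportedOn_xhat hη hs ht ω).sub (hz ω).1)]
    exact mul_le_mul_of_nonneg_left (strong_monotone hconv _ _) hn'.le
  have hv : ∫ ω, ∑ i, ‖V ω i‖ ^ 2 ∂Pr ≤ n * (2 * L ^ 2 * (∫ ω, ‖R.xhat s t ω - z‖ ^ 2 ∂Pr
        + ∫ ω, ‖R.xin s 0 ω - z‖ ^ 2 ∂Pr)) := by
    rw [← integral_add Ih I0, ← integral_const_mul, ← integral_const_mul]
    exact integral_mono (fsum fun a _ => ‖a‖ ^ 2) (((Ih.add I0).const_mul _).const_mul _)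
      fun ω => sum_norm_centeredGrad_sq_le hn hdiff hsmooth hocc _ _ _ _
  have hb' := mul_le_mul_of_nonneg_left hb (by positivity : 0 ≤ 2 * η * (1 / (n : ℝ)))
  have hv' := mul_le_mul_of_nonneg_left hv (by positivity : 0 ≤ 2 * η ^ 2 * (1 / (n : ℝ)))
  have e1 : ∀ c y : ℝ, c * (1 / (n : ℝ)) * (n * y) = c * y := fun c y => by field_simp
  rw [e1] at hb' hv'
  linarith

/-- Half of the contraction budget goes to (1 - ημ/2)^K ≤ 1/3, half to the variance at the reference
point, (ημ/6)/(ημ/2) = 1/3. -/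
theorem integral_outer_le {μ L : ℝ} (hμ : 0 < μ) (hη : 0 < η) (hn : 0 < n) (hΔ : 0 < Q.Delta)
    (hdiff : ∀ i, Differentiable ℝ (Q.f i))
    (hconv : ∀ x x' : EuclideanSpace ℝ (Fin p),
      Q.F x + inner ℝ (gradient Q.F x) (x' - x) + μ / 2 * ‖x' - x‖ ^ 2 ≤ Q.F x')
    (hsmooth : ∀ i, ∀ x x' : EuclideanSpace ℝ (Fin p),
      ‖gradient (Q.Fi i) x - gradient (Q.Fi i) x'‖ ≤ L * ‖x - x'‖)
    (hocc : ∀ k, Q.occ (Q.blk k) ≠ 0)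
    (hτ : √Q.Delta * τ ≤ 1 / 10) (hη1 : η * L ^ 2 ≤ μ / 24) (hη2 : η * μ ≤ 1 / 24)
    (hη3 : η * μ * τ ≤ 1 / 10) (hK : (1 - η * μ / 2) ^ K ≤ 1 / 3)
    {s : ℕ} (hs : s < S) {z : EuclideanSpace ℝ (Fin p)}
    (hz : ∀ ω, Q.IsSolution (R.B (s + 1) ω) z) :
    ∫ ω, ‖R.x (s + 1) ω - z‖ ^ 2 ∂Pr ≤ 2 / 3 * ∫ ω, ‖R.x s ω - z‖ ^ 2 ∂Pr := by
  set a : ℕ → ℝ := fun t => ∫ ω, ‖R.xin s t ω - z‖ ^ 2 ∂Pr with ha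
  set D : ℕ → ℝ := fun t => ∫ ω, ‖R.upd s t ω‖ ^ 2 ∂Pr with hDdef
  have ha0 : ∀ t, 0 ≤ a t := fun t => integral_nonneg fun ω => sq_nonneg _
  have hD : ∀ t, 0 ≤ D t := fun t => integral_nonneg fun ω => sq_nonneg _
  have hημ : 0 < η * μ := mul_pos hη hμ
  have hsD := Real.sqrt_nonneg Q.Delta
  have hrec : ∀ t < K, a (t + 1) ≤ (1 - η * μ / 2) * a t + η * μ / 6 * a 0 - 2 / 5 * D t
      + (√Q.Delta + 11 / 10 * (η * μ)) * ∑ u ∈ Finset.Ico (t - τ) t, D u := by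
    intro t ht
    have h1 := R.integral_step_le hη hn hdiff hconv hsmooth hocc hs hz ht
    have h2 := R.two_integral_inner_upd_le hη hn hΔ hs ht
    have h3 := R.integral_norm_xin_sub_xhat_sq_le hη hn hΔ hs ht
    have fx := R.finitelyMeasurable_xin hs ht.le
    have fh := R.finitelyMeasurable_xhat' hs ht
    -- The decrease is measured at the read; this moves it to the iterate at the price of the
    -- inconsistency. Of the available 2ημ - ημ/6, the amount ημ is spent here and the rest dropped.
    have h4 : a t ≤ 2 * ∫ ω, ‖R.xhat s t ω - z‖ ^ 2 ∂Pr
        + 2 * ∫ ω, ‖R.xin s t ω - R.xhat s t ω‖ ^ 2 ∂Pr := by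
      have I1 := ((fh.comp fun b => 2 * ‖b - z‖ ^ 2).integrable le_rfl : Integrable _ Pr)
      have I2 := ((fx.comp₂ fh fun b c => 2 * ‖b - c‖ ^ 2).integrable le_rfl : Integrable _ Pr)
      rw [← integral_const_mul, ← integral_const_mul, ← integral_add I1 I2]
      refine integral_mono ((fx.comp fun b => ‖b - z‖ ^ 2).integrable le_rfl) (I1.add I2)
        fun ω => ?_
      have e : R.xin s t ω - z = (R.xhat s t ω - z) + (R.xin s t ω - R.xhat s t ω) := by abel
      simp only
      have hp := parallelogram_law_with_norm ℝ (R.xhat s t ω - z) (R.xin s t ω - R.xhat s t ω)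
      rw [← e] at hp
      have := mul_self_nonneg ‖R.xhat s t ω - z - (R.xin s t ω - R.xhat s t ω)‖
      show ‖R.xin s t ω - z‖ ^ 2 ≤ 2 * ‖R.xhat s t ω - z‖ ^ 2
        + 2 * ‖R.xin s t ω - R.xhat s t ω‖ ^ 2
      nlinarith
    have hb : 0 ≤ ∫ ω, ‖R.xhat s t ω - z‖ ^ 2 ∂Pr := integral_nonneg fun ω => sq_nonneg _
    change a (t + 1) ≤ a t - 1 / 2 * D t - _ + 2 * η ^ 2 * (2 * L ^ 2 * (_ + a 0)) + _ at h1
    change _ ≤ √Q.Delta * τ * D t + √Q.Delta * ∑ u ∈ Finset.Ico (t - τ) t, D u at h2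
    change _ ≤ (1 + √Q.Delta * τ) * ∑ u ∈ Finset.Ico (t - τ) t, D u at h3
    set b := ∫ ω, ‖R.xhat s t ω - z‖ ^ 2 ∂Pr
    set X := ∫ ω, ‖R.xin s t ω - R.xhat s t ω‖ ^ 2 ∂Pr
    set w := ∑ u ∈ Finset.Ico (t - τ) t, D u with hSw
    have hSw0 : 0 ≤ w := Finset.sum_nonneg fun u _ => hD u
    have h5 : 2 * η ^ 2 * (2 * L ^ 2 * (b + a 0)) ≤ η * μ / 6 * (b + a 0) := by
      have h6 : 4 * (η * L ^ 2) * η ≤ μ / 6 * η :=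
        mul_le_mul_of_nonneg_right (by linarith) hη.le
      have h7 := mul_le_mul_of_nonneg_right h6 (add_nonneg hb (ha0 0))
      linarith
    have h6 : √Q.Delta * τ * D t ≤ 1 / 10 * D t := mul_le_mul_of_nonneg_right hτ (hD t)
    have h7 : X ≤ 11 / 10 * w := by
      have := mul_le_mul_of_nonneg_right hτ hSw0
      linarith
    have h8 := mul_le_mul_of_nonneg_left h7 hημ.le
    have h9 := mul_le_mul_of_nonneg_left h4 hημ.le
    have h10 := mul_nonneg hημ.le hb
    linarith
  -- The window condition holds with room: βτ ≤ 1/10 + 11/100 ≤ (9/10)(2/5).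
  have hfin := le_of_window_recursion (r := η * μ / 2) (by positivity) (by linarith)
    (by linarith) (mul_nonneg (by positivity) (ha0 0)) (by positivity)
    (by rw [add_mul]; linarith) hD hrec
  have hx1 : ∫ ω, ‖R.x (s + 1) ω - z‖ ^ 2 ∂Pr = a K := by
    simp only [ha, R.x_succ s hs]
  -- Dropping screened coordinates only brings the iterate closer to z, which vanishes there.
  have hx0 : a 0 ≤ ∫ ω, ‖R.x s ω - z‖ ^ 2 ∂Pr := by
    refine integral_mono (((R.finitelyMeasurable_xin hs (Nat.zero_le K)).comp
        fun b => ‖b - z‖ ^ 2).integrable le_rfl)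
      (((R.finitelyMeasurable_x hs.le).comp fun b => ‖b - z‖ ^ 2).integrable le_rfl) fun ω => ?_
    simp only [R.xin_zero s hs]
    exact Q.norm_restr_sub_sq_le (hz ω).1 _
  have e : η * μ / 6 * a 0 / (η * μ / 2) = 1 / 3 * a 0 := by field_simp; ring
  rw [e] at hfin
  have := mul_le_mul_of_nonneg_right hK (ha0 0)
  rw [hx1]
  linarith

end ShaDDSS

end CompositeProblem

/-! ### Step size and loop length -/

theorem ddssStep_bounds {μ L : ℝ} (hμ : 0 < μ) (hL : 0 < L) (hμL : μ ≤ L) (τ : ℕ) :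
    0 < ddssStep μ L τ ∧ ddssStep μ L τ * L ^ 2 ≤ μ / 24 ∧ ddssStep μ L τ * μ ≤ 1 / 24 ∧
      ddssStep μ L τ * μ * τ ≤ 1 / 10 := by
  have hpos : 0 < ddssStep μ L τ := by
    unfold ddssStep
    split_ifs with h
    · exact lt_min (by positivity) (by positivity)
    · have : (0 : ℝ) < τ := Nat.cast_pos.2 (Nat.pos_of_ne_zero h)
      exact lt_min (lt_min (by positivity) (by positivity)) (by positivity)
  have h1 : ddssStep μ L τ ≤ 1 / (24 * (L / μ) * L) := by
    unfold ddssStep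
    split_ifs
    · exact min_le_left _ _
    · exact (min_le_left _ _).trans (min_le_left _ _)
  have h2 : ddssStep μ L τ * L ^ 2 ≤ μ / 24 := by
    have := mul_le_mul_of_nonneg_right h1 (sq_nonneg L)
    have e : 1 / (24 * (L / μ) * L) * L ^ 2 = μ / 24 := by field_simp
    linarith
  refine ⟨hpos, h2, ?_, ?_⟩
  -- From μ ≤ L and η ≤ μ/(24L²).
  · have h3 : ddssStep μ L τ * μ * μ ≤ ddssStep μ L τ * L ^ 2 := by
      rw [mul_assoc, ← sq]
      gcongr
    by_contra! h
    have := mul_lt_mul_of_pos_right h hμ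
    linarith
  · rcases Nat.eq_zero_or_pos τ with rfl | hτ
    · norm_num
    · have hτ' : (0 : ℝ) < τ := Nat.cast_pos.2 hτ
      have h3 : ddssStep μ L τ ≤ (L / μ) / (10 * τ * L) := by
        unfold ddssStep
        rw [if_neg hτ.ne']
        exact min_le_right _ _
      have := mul_le_mul_of_nonneg_right h3 (mul_pos hμ hτ').le
      have e : (L / μ) / (10 * τ * L) * (μ * τ) = 1 / 10 := by field_simp
      linarith

/-- K r/2 ≈ 2 log 3 is twice what is needed, so losing r/2 to rounding down is harmless: log 3 ≥ 2/3
exceeds it. -/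
theorem one_sub_half_pow_le {r : ℝ} (hr : 0 < r) (hr1 : r ≤ 1 / 24) {K : ℕ}
    (hK : K = ⌈4 * Real.log 3 / r⌉₊ ∨ K = ⌊4 * Real.log 3 / r⌋₊) : (1 - r / 2) ^ K ≤ 1 / 3 := by
  have hK' : 4 * Real.log 3 / r - 1 ≤ K := by
    rcases hK with rfl | rfl
    · have := Nat.le_ceil (4 * Real.log 3 / r)
      linarith
    · exact (Nat.sub_one_lt_floor _).le
  have hlog : 1 - (3 : ℝ)⁻¹ ≤ Real.log 3 := Real.one_sub_inv_le_log_of_pos (by norm_num)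
  have h1 : Real.log 3 ≤ K * (r / 2) := by
    have h2 := mul_le_mul_of_nonneg_right hK' (half_pos hr).le
    have e : (4 * Real.log 3 / r - 1) * (r / 2) = 2 * Real.log 3 - r / 2 := by
      field_simp; ring
    norm_num at hlog
    linarith
  calc (1 - r / 2) ^ K ≤ Real.exp (-(r / 2)) ^ K := by
        refine pow_le_pow_left₀ (by linarith) ?_ K
        have := Real.add_one_le_exp (-(r / 2))
        linarith
    _ = Real.exp (-(K * (r / 2))) := by rw [← Real.exp_nat_mul]; congr 1; ring
    _ ≤ Real.exp (-Real.log 3) := Real.exp_le_exp.2 (neg_le_neg h1)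
    _ = 1 / 3 := by rw [Real.exp_neg, Real.exp_log (by norm_num), one_div]

/-! ### The convergence theorem -/

theorem theorem1 {n p q : ℕ} (Q : CompositeProblem n p q)
    (μ L ℓ : ℝ) (hμ : 0 < μ) (hL : 0 < L) (hℓ : 0 < ℓ)
    (hdiff : ∀ i, Differentiable ℝ (Q.f i))
    -- strong convexity of `F`
    (hconv : ∀ x x' : EuclideanSpace ℝ (Fin p),
      Q.F x + inner ℝ (gradient Q.F x) (x' - x) + μ / 2 * ‖x' - x‖ ^ 2 ≤ Q.F x')
    -- smoothness of each `F_i`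
    (hsmooth : ∀ i, ∀ x x' : EuclideanSpace ℝ (Fin p),
      ‖gradient (Q.Fi i) x - gradient (Q.Fi i) x'‖ ≤ L * ‖x - x'‖)
    -- the constant in the screening rule is a Lipschitz constant of the derivatives `f_i'`
    (hscalar : ∀ i, ∀ z z' : ℝ, |deriv (Q.f i) z - deriv (Q.f i) z'| ≤ ℓ * |z - z'|)
    -- normalization of the dual point
    (σ c : ℝ) (hσ : 0 < σ) (hc : 0 < c) (hc' : c ≤ n * Q.lam)
    -- bound on the overlap
    (τ : ℕ) (hτ : (τ : ℝ) ≤ 1 / (10 * √Q.Delta))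
    -- step size and length of the inner loop (rounded up or down)
    (η : ℝ) (hη : η = ddssStep μ L τ)
    (K : ℕ) (hK : K = ⌈4 * Real.log 3 / (η * μ)⌉₊ ∨ K = ⌊4 * Real.log 3 / (η * μ)⌋₊)
    (S : ℕ) (x₀ : EuclideanSpace ℝ (Fin p))
    {W : Type*} [MeasurableSpace W] (Pr : MeasureTheory.Measure W)
    [MeasureTheory.IsProbabilityMeasure Pr]
    (R : Q.ShaDDSS σ c ℓ η τ K S x₀ Pr)
    -- the solutions of the sub-problems
    (xstar : Finset (Fin q) → EuclideanSpace ℝ (Fin p))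
    (hstar : ∀ B, Q.IsSolution B (xstar B)) :
    (∀ ω, xstar (R.B S ω) = xstar Finset.univ) ∧
    MeasureTheory.Integrable (fun ω => ‖R.x S ω - xstar (R.B S ω)‖ ^ 2) Pr ∧
    ∫ ω, ‖R.x S ω - xstar (R.B S ω)‖ ^ 2 ∂Pr
      ≤ (2 / 3 : ℝ) ^ S * ‖x₀ - xstar Finset.univ‖ ^ 2 := by
  obtain ⟨ω₀⟩ := MeasureTheory.nonempty_of_isProbabilityMeasure Pr
  have hn : 0 < n := (R.idx 0 0 ω₀).pos
  -- In dimension 0 neither μ ≤ L nor Δ > 0 can be derived, but all distances vanish.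
  rcases isEmpty_or_nonempty (Fin p) with hp | ⟨⟨k₀⟩⟩
  · have h0 : ∀ x y : EuclideanSpace ℝ (Fin p), x = y := fun x y => by
      ext k; exact hp.elim k
    have h1 : ∀ ω, ‖R.x S ω - xstar (R.B S ω)‖ ^ 2 = 0 := fun ω => by
      rw [h0 (R.x S ω) (xstar (R.B S ω))]; simp
    simp only [h1]
    refine ⟨fun ω => h0 _ _, MeasureTheory.integrable_zero _ _ _, ?_⟩
    simp only [MeasureTheory.integral_zero]
    positivity
  · have hocc := CompositeProblem.occ_ne_zero hμ hdiff hconv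
    have hΔ := CompositeProblem.Delta_pos hn (hocc k₀)
    have hμL := CompositeProblem.strong_convexity_le_smoothness hn hdiff hconv hsmooth k₀
    obtain ⟨hη0, hη1, hη2, hη3⟩ := ddssStep_bounds hμ hL hμL τ
    rw [← hη] at hη0 hη1 hη2 hη3
    have hpow := one_sub_half_pow_le (mul_pos hη0 hμ) hη2 hK
    have hτ' : √Q.Delta * τ ≤ 1 / 10 := by
      have hs := Real.sqrt_pos.2 hΔ
      have := mul_le_mul_of_nonneg_left hτ hs.le
      have e : √Q.Delta * (1 / (10 * √Q.Delta)) = 1 / 10 := by field_simp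
      linarith
    have hsafe : ∀ s ≤ S, ∀ ω, Q.IsSolution (R.B s ω) (xstar Finset.univ) := fun s hs ω =>
      (R.screening_safe hη0 hn hℓ hdiff hscalar hc hc' (hstar _) hs ω).2
    -- By safety the distance can be measured to one fixed point, so the loop contractions chain
    -- although the active sets are random.
    have hrate : ∀ s ≤ S, ∫ ω, ‖R.x s ω - xstar Finset.univ‖ ^ 2 ∂Pr
        ≤ (2 / 3 : ℝ) ^ s * ‖x₀ - xstar Finset.univ‖ ^ 2 := by
      intro s
      induction s with
      | zero => intro _; simp [R.x_zero]
      | succ s ih =>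
        intro hs
        have h1 := R.integral_outer_le hμ hη0 hn hΔ hdiff hconv hsmooth hocc hτ' hη1 hη2 hη3 hpow
          hs (hsafe (s + 1) hs)
        have h2 := ih (Nat.le_of_succ_le hs)
        rw [pow_succ]
        linarith
    have heq : ∀ ω, xstar (R.B S ω) = xstar Finset.univ := fun ω =>
      (hsafe S le_rfl ω).unique hμ hdiff hconv (hstar _)
    refine ⟨heq, ?_, ?_⟩
    · simp only [heq]
      exact ((R.finitelyMeasurable_x le_rfl).comp
        fun x => ‖x - xstar Finset.univ‖ ^ 2).integrable le_rfl
    · simp only [heq]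
      exact hrate S le_rfl
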